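/- **Setting.** Let $K$ be a field of characteristic $0$. Functions of the times $t_1=x,t_2,t_3,\dots$ are formal Taylor series over $K$ at a base point $t^0$ with finitely many non-zero coordinates; "invertible" means non-vanishing at $t^0$. Let $r,m\ge 1$, $D=\partial_x$; for a pseudo-differential operator $A=\sum_j A_jD^j$ put $A_+=\sum_{j\ge0}A_jD^j$, $A_-=A-A_+$, and let $A(f)$ denote the action on a function $f$. Let $L$ be a Lax operator of the constrained KP hierarchy $\mathsf{cKP}_{r,m}$: $L=WD^rW^{-1}$ with $W=1+\sum_{k\ge1}w_kD^{-k}$, $L^{l/r}=WD^lW^{-1}$, $\partial W/\partial t_l=-(L^{l/r})_-W$ for all $l\ge 1$ (hence $\partial L/\partial t_l=[(L^{l/r})_+,L]$), and $$L=L_++\sum_{i=1}^m\Phi_iD^{-1}\Psi_i,\qquad \frac{\partial\Phi_i}{\partial t_l}=(L^{l/r})_+(\Phi_i),\qquad \frac{\partial\Psi_i}{\partial t_l}=-\big((L^{l/r})_+\big)^*(\Psi_i).$$ Let $M=W\Big(\sum_{l\ge1}\frac lr t_lD^{l-r}\Big)W^{-1}$. Suppose that $L$ and the $\Phi_i$ are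 invariant under the lowest additional symmetry flow ("string condition"), i.e. $$\partial^*_0L:=-[M_-,L]=0,\qquad \partial_0^*\Phi_i:=M_+(\Phi_i)=0\quad(1\le i\le m).$$ Put $\chi^{(0)}_i=\Phi_i$ and $\chi_i^{(s+1)}=L(\chi_i^{(s)})$, where $L(f)=L_+(f)+\sum_j\Phi_j\,\partial_x^{-1}(\Psi_jf)$ with any choice of $x$-antiderivatives. For $n=km+l$ with $k\ge0$, $0\le l<m$, let $$W_n=W\big[\Phi_1,\dots,\Phi_m,\chi^{(1)}_1,\dots,\chi^{(1)}_m,\dots,\chi^{(k-1)}_1,\dots,\chi^{(k-1)}_m,\chi^{(k)}_1,\dots,\chi^{(k)}_l\big]$$ be the Wronskian in $x$ of the first $n$ of these functions ($W_0=1$; for $m=1$ this is $W[\Phi,L(\Phi),\dots,L^{n-1}(\Phi)]$). Starting from $L^{(0)}=L$, $\Phi_i^{(0)}=\Phi_i$, $\Psi_i^{(0)}=\Psi_i$, consider the Darboux–Bäcklund orbit in which step $q=0,1,2,\dots$ is generated by the eigenfunction with index $a\equiv q+1 \pmod m$, $1\le a\le m$, assumed invertible: with $T=\Phi^{(q)}_aD(\Phi^{(q)}_a)^{-1}$,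 $$L^{(q+1)}=TL^{(q)}T^{-1},\quad \Phi_a^{(q+1)}=T\big(L^{(q)}(\Phi_a^{(q)})\big),\quad \Psi_a^{(q+1)}=(\Phi_a^{(q)})^{-1},$$ $$\Phi_i^{(q+1)}=T(\Phi_i^{(q)}),\quad \Psi_i^{(q+1)}=-(\Phi_a^{(q)})^{-1}\partial_x^{-1}(\Psi_i^{(q)}\Phi_a^{(q)})\quad(i\ne a),$$ where the antiderivatives $\partial_x^{-1}(\Psi_j^{(q)}\Phi_a^{(q)})$ are chosen arbitrarily, but the same in $L^{(q)}(\Phi_a^{(q)})=L^{(q)}_+(\Phi_a^{(q)})+\sum_j\Phi^{(q)}_j\partial_x^{-1}(\Psi^{(q)}_j\Phi^{(q)}_a)$ and in $\Psi_i^{(q+1)}$. Let $\tau^{(0)}$ be an invertible $\tau$-function of $L$ ($\partial_x\partial_{t_l}\ln\tau^{(0)}=\mathrm{Res}\,L^{l/r}$ for all $l\ge1$) and let $\tau^{(q+1)}=\Phi_a^{(q)}\tau^{(q)}$ ($a\equiv q+1$ mod $m$) be the $\tau$-functions along the orbit. **Proposition.** For every $n\ge0$, $$\Big(\sum_{l\ge1}\frac{l+r}{r}\,t_{r+l}\frac{\partial}{\partial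 t_l}+n\,t_r\Big)W_n=0,$$ and if the orbit exists up to step $n$ (the first $n$ generating eigenfunctions are invertible), then $$\frac{\tau^{(n)}}{\tau^{(0)}}=W_n\qquad\text{and hence}\qquad \Big(\sum_{l\ge1}\frac{l+r}{r}\,t_{r+l}\frac{\partial}{\partial t_l}+n\,t_r\Big)\frac{\tau^{(n)}}{\tau^{(0)}}=0.$$ -/

import Mathlib

noncomputable section

namespace CKP

/-! Functions of the times `t₁ = x, t₂, t₃, …` are formal Taylor series at a base point `t0`, a
point with finitely many non-zero times: the variable `X l` is `t_l - t0_l`. -/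

/-- Functions of the infinitely many times `t_l`, `l ≥ 1`. -/
abbrev Fn (K : Type*) : Type _ := MvPowerSeries ℕ+ K

variable {K : Type*} [Field K]

/-- The time `t_l` as a function. -/
def time (t0 : ℕ+ →₀ K) (l : ℕ+) : Fn K := MvPowerSeries.C (t0 l) + MvPowerSeries.X l

/-- The partial derivative `∂/∂t_l`. -/
def dt (l : ℕ+) (f : Fn K) : Fn K := MvPowerSeries.pderiv K l f

/-- The partial derivative `∂/∂x`, with `x = t₁`. -/
def dx (f : Fn K) : Fn K := dt 1 f

/-- A constant function. -/
def const (c : K) : Fn K := MvPowerSeries.C c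

/-- The sum, coefficient by coefficient, of a family of which only finitely many members
contribute to each Taylor coefficient. -/
def formalSum {ι : Type*} (g : ι → Fn K) : Fn K :=
  fun a => ∑ᶠ i, MvPowerSeries.coeff a (g i)

/-- Families with coefficients proportional to the times `t_{r+l}` can be summed over `l`. -/
theorem finite_time_mul (t0 : ℕ+ →₀ K) (r : ℕ+) (g : ℕ+ → Fn K) (a : ℕ+ →₀ ℕ) :
    {l : ℕ+ | MvPowerSeries.coeff a (time t0 (r + l) * g l) ≠ 0}.Finite := by
  classical
  refine Set.Finite.subset (s := (fun l => r + l) ⁻¹' ((t0.support ∪ a.support : Finset ℕ+) :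
    Set ℕ+)) (Set.Finite.preimage (fun _ _ _ _ h => add_left_cancel h) (Finset.finite_toSet _)) ?_
  intro l hl
  by_contra hn
  simp only [Set.mem_preimage, Finset.coe_union, Set.mem_union, Finset.mem_coe,
    Finsupp.mem_support_iff, not_or, not_not] at hn
  apply hl
  rw [time, hn.1, map_zero, zero_add, MvPowerSeries.coeff_mul]
  refine Finset.sum_eq_zero fun p hp => ?_
  rw [MvPowerSeries.coeff_X, if_neg, zero_mul]
  rintro h
  have h1 : p.1 + p.2 = a := Finset.HasAntidiagonal.mem_antidiagonal.mp hp
  have h2 := DFunLike.congr_fun h1 (r + l)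
  rw [h, hn.2] at h2
  simp at h2

/-! ### Formal pseudo-differential operators `∑_j P_j D^j` -/

variable (K) in
/-- Coefficient sequences `j ↦ P_j`, `j ∈ ℤ`, with `P_j = 0` for all large `j`. -/
def symbols : AddSubgroup (ℤ → Fn K) where
  carrier := {P | ∃ N : ℤ, ∀ j, N < j → P j = 0}
  zero_mem' := ⟨0, fun _ _ => rfl⟩
  add_mem' := by
    rintro P Q ⟨N, hN⟩ ⟨M, hM⟩
    refine ⟨max N M, fun j hj => ?_⟩
    rw [Pi.add_apply, hN j (lt_of_le_of_lt (le_max_left _ _) hj),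
      hM j (lt_of_le_of_lt (le_max_right _ _) hj), add_zero]
  neg_mem' := by
    rintro P ⟨N, hN⟩
    exact ⟨N, fun j hj => by rw [Pi.neg_apply, hN j hj, neg_zero]⟩

variable (K) in
/-- Formal pseudo-differential operators in `D = ∂_x`; `P.1 j` is the coefficient of `D^j`
(coefficients stand on the left). -/
abbrev PsiDO : Type _ := symbols K

/-- The `D^n`-coefficient of `P Q`, from the generalized Leibniz rule
`D^i f = ∑_{k ≥ 0} (i choose k) (∂_x^k f) D^{i-k}`, `i ∈ ℤ`. -/
def mulCoeff (P Q : PsiDO K) (n : ℤ) : Fn K :=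
  ∑ᶠ p : ℤ × ℕ, Ring.choose p.1 p.2 • (P.1 p.1 * dx^[p.2] (Q.1 (n - p.1 + p.2)))

theorem dx_iterate_zero (k : ℕ) : dx^[k] (0 : Fn K) = 0 :=
  Function.iterate_fixed (by simp [dx, dt]) k

/-- Each coefficient of a product is a finite sum. -/
theorem finite_mul_support (P Q : PsiDO K) (n : ℤ) :
    (Function.support fun p : ℤ × ℕ =>
      Ring.choose p.1 p.2 • (P.1 p.1 * dx^[p.2] (Q.1 (n - p.1 + p.2)))).Finite := by
  obtain ⟨N, hN⟩ := P.2
  obtain ⟨M, hM⟩ := Q.2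
  refine Set.Finite.subset
    ((Set.finite_Icc (n - M) N).prod (Set.finite_Iic (M - n + N).toNat)) ?_
  rintro ⟨i, k⟩ h
  have h1 : i ≤ N := by
    by_contra hc
    exact h (by simp [hN i (not_le.mp hc)])
  have h2 : n - i + k ≤ M := by
    by_contra hc
    exact h (by simp only [hM _ (not_le.mp hc), dx_iterate_zero, mul_zero, smul_zero])
  simp only [Set.mem_prod, Set.mem_Icc, Set.mem_Iic]
  omega

instance : Mul (PsiDO K) where
  mul P Q := ⟨mulCoeff P Q, by
    obtain ⟨N, hN⟩ := P.2
    obtain ⟨M, hM⟩ := Q.2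
    refine ⟨N + M, fun n hn => finsum_eq_zero_of_forall_eq_zero ?_⟩
    rintro ⟨i, k⟩
    by_cases hi : N < i
    · simp [hN i hi]
    · have : M < n - i + k := by omega
      simp only [hM _ this, dx_iterate_zero, mul_zero, smul_zero]⟩

/-- The operator `f D^j`. -/
def mono (f : Fn K) (j : ℤ) : PsiDO K :=
  ⟨fun i => if i = j then f else 0, j, fun _ hi => if_neg (ne_of_gt hi)⟩

/-- The operator `D^j`. -/
def D (j : ℤ) : PsiDO K := mono 1 j

/-- Multiplication by the function `f`, as an operator of order zero. -/
def fn (f : Fn K) : PsiDO K := mono f 0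

/-- The purely pseudo-differential part `∑_{j < 0} A_j D^j` of `∑_j A_j D^j`. -/
def negPart (A : ℤ → Fn K) : PsiDO K :=
  ⟨fun j => if j < 0 then A j else 0, 0, fun j hj => if_neg (by omega)⟩

/-- `P_+(f)`: the differential part of `P` applied to the function `f`. -/
def act (P : PsiDO K) (f : Fn K) : Fn K :=
  ∑ᶠ j : ℕ, P.1 j * dx^[j] f

/-- `(P_+)^*(g)`: the formal adjoint of the differential part of `P` applied to `g`. -/
def adjAct (P : PsiDO K) (g : Fn K) : Fn K :=
  ∑ᶠ j : ℕ, (-1) ^ j * dx^[j] (P.1 j * g)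

/-! ### The constrained KP hierarchy -/

/-- `L^{l/r} = W D^l W⁻¹`; for `l = r` this is the Lax operator `L` itself. -/
def laxPow (W Winv : PsiDO K) (l : ℕ+) : PsiDO K := W * D (l : ℕ) * Winv

/-- `W = 1 + ∑_{n ≥ 1} w_n D^{-n}` with inverse `Winv` solves the Wilson–Sato equations
`∂W/∂t_l = - (L^{l/r})_- W`, `l ≥ 1`. -/
structure IsDressing (W Winv : PsiDO K) : Prop where
  coeff_zero : W.1 0 = 1
  coeff_pos : ∀ j : ℤ, 0 < j → W.1 j = 0
  mul_inv : W * Winv = D 0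
  inv_mul : Winv * W = D 0
  sato : ∀ (l : ℕ+) (j : ℤ), dt l (W.1 j) = -(negPart (laxPow W Winv l).1 * W).1 j

/-- A solution of the constrained KP hierarchy `cKP_{r,m}`: the Lax operator `L = W D^r W⁻¹`
solves the KP flows, `L_- = ∑_i Φ_i D⁻¹ Ψ_i`, and the `Φ_i`, `Ψ_i` are eigenfunctions and adjoint
eigenfunctions of `L`. -/
structure IsCKP (r : ℕ+) {m : ℕ} (W Winv : PsiDO K) (Φ Ψ : Fin m → Fn K) : Prop where
  dressing : IsDressing W Winv
  lax_neg : negPart (laxPow W Winv r).1 = ∑ i, fn (Φ i) * D (-1) * fn (Ψ i)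
  eigen : ∀ (l : ℕ+) (i : Fin m), dt l (Φ i) = act (laxPow W Winv l) (Φ i)
  adj_eigen : ∀ (l : ℕ+) (i : Fin m), dt l (Ψ i) = -adjAct (laxPow W Winv l) (Ψ i)

/-- `g` is a value of `L(f) = L_+(f) + ∑_j Φ_j ∂_x⁻¹(Ψ_j f)`, for some choice `S j` of the
`x`-antiderivatives `∂_x⁻¹(Ψ_j f)`. -/
def LaxActs {m : ℕ} (L : PsiDO K) (Φ Ψ : Fin m → Fn K) (f g : Fn K) : Prop :=
  ∃ S : Fin m → Fn K, (∀ j, dx (S j) = Ψ j * f) ∧ g = act L f + ∑ j, Φ j * S j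

/-- `τ` is a (non-vanishing) tau-function of the hierarchy: `∂_x ∂_{t_l} ln τ = Res L^{l/r}`,
with the logarithmic derivative written out. -/
def IsTau (W Winv : PsiDO K) (τ : Fn K) : Prop :=
  IsUnit τ ∧ ∀ l : ℕ+,
    τ * dx (dt l τ) - dx τ * dt l τ = τ ^ 2 * (laxPow W Winv l).1 (-1)

/-! ### The lowest additional symmetry flow -/

/-- `X_{(r)} = ∑_{l=1}^r (l/r) t_l D^{l-r}`. -/
def bareX (t0 : ℕ+ →₀ K) (r : ℕ+) : PsiDO K :=
  ∑ l ∈ Finset.Icc 1 r,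
    mono (const (((l : ℕ) : K) / ((r : ℕ) : K)) * time t0 l) ((l : ℕ) - (r : ℕ) : ℤ)

/-- The `D^j`-coefficients of
`M = W (∑_{l ≥ 1} (l/r) t_l D^{l-r}) W⁻¹ = W X_{(r)} W⁻¹ + ∑_{l ≥ 1} ((l+r)/r) t_{r+l} L^{l/r}`
(a formal operator of infinite order). -/
def opM (t0 : ℕ+ →₀ K) (r : ℕ+) (W Winv : PsiDO K) (j : ℤ) : Fn K :=
  (W * bareX t0 r * Winv).1 j + formalSum fun l : ℕ+ =>
    time t0 (r + l) * (const (((l : ℕ) + (r : ℕ) : K) / ((r : ℕ) : K)) * (laxPow W Winv l).1 j)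

/-- The flow `∂*_0 L = -[M_-, L]` on the Lax operator. -/
def flowL (t0 : ℕ+ →₀ K) (r : ℕ+) (W Winv : PsiDO K) : PsiDO K :=
  -(negPart (opM t0 r W Winv) * laxPow W Winv r - laxPow W Winv r * negPart (opM t0 r W Winv))

/-- The flow `∂*_0 Φ = M_+(Φ)` on an eigenfunction. -/
def flowPhi (t0 : ℕ+ →₀ K) (r : ℕ+) (W Winv : PsiDO K) (Φ : Fn K) : Fn K :=
  formalSum fun j : ℕ => opM t0 r W Winv j * dx^[j] Φ

/-- The operator `∑_{l ≥ 1} ((l+r)/r) t_{r+l} ∂/∂t_l + n t_r`. -/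
def stringOp (t0 : ℕ+ →₀ K) (r : ℕ+) (n : ℕ) (f : Fn K) : Fn K :=
  (formalSum fun l : ℕ+ =>
    time t0 (r + l) * (const (((l : ℕ) + (r : ℕ) : K) / ((r : ℕ) : K)) * dt l f))
  + n * time t0 r * f

/-! ### Darboux–Bäcklund orbits and Wronskians -/

/-- The Wronskian `det (∂_x^i f_j)`, `0 ≤ i, j < n`. -/
def wronskian (n : ℕ) (f : ℕ → Fn K) : Fn K :=
  Matrix.det (Matrix.of fun i j : Fin n => dx^[(i : ℕ)] (f j))

/-- The auto-Darboux–Bäcklund transformation with `T = Φ_a D Φ_a⁻¹` (the generating eigenfunction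
is invertible), where `S j` is the chosen value of `∂_x⁻¹(Ψ_j Φ_a)`:
`L' = T L T⁻¹`, `Φ'_a = T(L(Φ_a))`, `Ψ'_a = Φ_a⁻¹`, and for `i ≠ a`
`Φ'_i = T(Φ_i)`, `Ψ'_i = -Φ_a⁻¹ ∂_x⁻¹(Ψ_i Φ_a)`. -/
structure IsDBStep {m : ℕ} (a : Fin m) (L : PsiDO K) (Φ Ψ S : Fin m → Fn K)
    (L' : PsiDO K) (Φ' Ψ' : Fin m → Fn K) : Prop where
  isUnit : IsUnit (Φ a)
  antideriv : ∀ j, dx (S j) = Ψ j * Φ a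
  lax : L' = (fn (Φ a) * D 1 * fn (Φ a)⁻¹) * L * (fn (Φ a) * D (-1) * fn (Φ a)⁻¹)
  phi_gen : Φ' a = Φ a * dx ((Φ a)⁻¹ * (act L (Φ a) + ∑ j, Φ j * S j))
  psi_gen : Ψ' a = (Φ a)⁻¹
  phi : ∀ i, i ≠ a → Φ' i = Φ a * dx ((Φ a)⁻¹ * Φ i)
  psi : ∀ i, i ≠ a → Ψ' i = -((Φ a)⁻¹ * S i)

/-- The index `k mod m` of the eigenfunction that generates step `k` of the orbit: the
eigenfunctions are used cyclically, `Φ_1, …, Φ_m, Φ_1, …` (numbered from zero here). -/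
def gen (m : ℕ) [NeZero m] (k : ℕ) : Fin m := ⟨k % m, Nat.mod_lt k (NeZero.pos m)⟩

/-- The first `n` steps of a Darboux–Bäcklund orbit, with `τ^{(k+1)} = Φ^{(k)}_{gen k} τ^{(k)}`. -/
structure IsDBOrbit {m : ℕ} [NeZero m] (n : ℕ) (L : ℕ → PsiDO K) (Φ Ψ : ℕ → Fin m → Fn K)
    (τ : ℕ → Fn K) : Prop where
  step : ∀ k, k < n → ∃ S : Fin m → Fn K,
    IsDBStep (gen m k) (L k) (Φ k) (Ψ k) S (L (k + 1)) (Φ (k + 1)) (Ψ (k + 1))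
  tau : ∀ k, k < n → τ (k + 1) = Φ k (gen m k) * τ k

end CKP

end

noncomputable section

namespace CKP

variable {K : Type*} [Field K]

/-! ### The ring of formal pseudo-differential operators -/

/-! Write δ for the derivation `euler`, the sum of ((l+r)/r) t_{r+l} ∂/∂t_l, and t for t_r.

String equation. Since W X_{(r)} W⁻¹ has order zero with leading coefficient t and its commutator
with L is -1, the two invariance conditions become δL + [t, L] = -1 (`IsDressing.string_lax`) and (δ
+ t)Φ_i = 0 (`IsDressing.flowPhi_eq`). The negative part of the first one, combined with the second,
gives ∑ Φ_i D⁻¹ (δΨ_i - tΨ_i) = 0. Hence (δ + t)L(f) + f is a value of L((δ + t)f)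
(`LaxActs.string`). By induction δ + t sends the k-th function of the list Φ_i, L(Φ_i), … to a
combination of the preceding ones (`string_mem_lowerSpan`). In Jacobi's formula this strictly
triangular part has trace zero, while multiplication by t contributes n t, whence δW_n + n t W_n = 0
(`string_wronskian`). No Darboux orbit is involved here.

Wronskian formula. Crum's identity W[f_0, …, f_n] = f_0 W[T f_1, …, T f_n], T = f_0 D f_0⁻¹, peels
off one factor (`wronskian_succ`). One Darboux step intertwines the nonlocal actions of L and L'
(`IsDBStep.laxActs`), so the functions T f_k form a list of the same kind for the transformed data
(`IsChain.step`). Iteration exhibits W_n as the product of the generating eigenfunctions, which is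
τ^{(n)}/τ^{(0)}.

The antiderivatives are arbitrary, so each function is determined only modulo combinations of
earlier ones with x-independent coefficients. Such combinations leave Wronskians unchanged, and all
inductions are therefore carried out modulo `lowerSpan`. -/

theorem dx_add (f g : Fn K) : dx (f + g) = dx f + dx g := map_add (MvPowerSeries.pderiv K 1) f g

theorem dx_zero : dx (0 : Fn K) = 0 := map_zero (MvPowerSeries.pderiv K 1)

theorem dx_one : dx (1 : Fn K) = 0 := (MvPowerSeries.pderiv K 1).map_one_eq_zero

theorem dx_mul (f g : Fn K) : dx (f * g) = dx f * g + f * dx g := by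
  change MvPowerSeries.pderiv K 1 (f * g) = _
  rw [Derivation.leibniz, smul_eq_mul, smul_eq_mul, add_comm, mul_comm g]
  rfl

theorem dx_iterate_eq (k : ℕ) :
    (dx^[k] : Fn K → Fn K) =
      (((MvPowerSeries.pderiv K (1 : ℕ+)).toLinearMap ^ k : Fn K →ₗ[K] Fn K) : Fn K → Fn K) :=
  (Module.End.coe_pow _ k).symm

theorem dx_iterate_add (k : ℕ) (f g : Fn K) : dx^[k] (f + g) = dx^[k] f + dx^[k] g := by
  rw [dx_iterate_eq, map_add]

theorem dx_iterate_one (k : ℕ) (hk : k ≠ 0) : dx^[k] (1 : Fn K) = 0 := by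
  obtain ⟨k, rfl⟩ := Nat.exists_eq_succ_of_ne_zero hk
  rw [Function.iterate_succ_apply, dx_one, dx_iterate_zero]

/-- The operator `P` has order at most `N`. -/
def OrdLE (P : PsiDO K) (N : ℤ) : Prop := ∀ j, N < j → P.1 j = 0

theorem exists_ordLE (P : PsiDO K) : ∃ N, OrdLE P N := P.2

theorem OrdLE.mono {P : PsiDO K} {N M : ℤ} (h : OrdLE P N) (hM : N ≤ M) : OrdLE P M :=
  fun j hj => h j (hM.trans_lt hj)

theorem coeff_mul (P Q : PsiDO K) (n : ℤ) : (P * Q).1 n = ∑ᶠ p : ℤ × ℕ,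
    Ring.choose p.1 p.2 • (P.1 p.1 * dx^[p.2] (Q.1 (n - p.1 + p.2))) := rfl

theorem OrdLE.mul {P Q : PsiDO K} {N M : ℤ} (hP : OrdLE P N) (hQ : OrdLE Q M) :
    OrdLE (P * Q) (N + M) := by
  intro n hn
  rw [coeff_mul]
  refine finsum_eq_zero_of_forall_eq_zero ?_
  rintro ⟨i, k⟩
  by_cases hi : N < i
  · simp [hP i hi]
  · have : M < n - i + k := by omega
    simp only [hQ _ this, dx_iterate_zero, mul_zero, smul_zero]

/-- A coefficient of a product as a sum over any sufficiently large box. -/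
theorem coeff_mul_box {P Q : PsiDO K} {N M : ℤ} (hP : OrdLE P N) (hQ : OrdLE Q M) {n A N' : ℤ}
    {B : ℕ} (hA : A ≤ n - M) (hN : N ≤ N') (hB : M - n + N < B) :
    (P * Q).1 n = ∑ i ∈ Finset.Icc A N', ∑ k ∈ Finset.range B,
      Ring.choose i k • (P.1 i * dx^[k] (Q.1 (n - i + k))) := by
  rw [coeff_mul, ← Finset.sum_product' (f := fun i k =>
    Ring.choose i k • (P.1 i * dx^[k] (Q.1 (n - i + k))))]
  refine finsum_eq_sum_of_support_subset _ ?_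
  rintro ⟨i, k⟩ h
  have h1 : i ≤ N := by
    by_contra hc
    exact h (by simp [hP i (not_le.mp hc)])
  have h2 : n - i + k ≤ M := by
    by_contra hc
    exact h (by simp only [hQ _ (not_le.mp hc), dx_iterate_zero, mul_zero, smul_zero])
  simp only [Finset.coe_product, Set.mem_prod, Finset.mem_coe, Finset.mem_Icc, Finset.mem_range]
  omega

theorem psido_ext {P Q : PsiDO K} (h : ∀ n, P.1 n = Q.1 n) : P = Q := Subtype.ext (funext h)

theorem coeff_add (P Q : PsiDO K) (n : ℤ) : (P + Q).1 n = P.1 n + Q.1 n := rfl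

theorem coeff_sub (P Q : PsiDO K) (n : ℤ) : (P - Q).1 n = P.1 n - Q.1 n := rfl

theorem coeff_zero (n : ℤ) : (0 : PsiDO K).1 n = 0 := rfl

theorem coeff_mono (f : Fn K) (j n : ℤ) : (mono f j).1 n = if n = j then f else 0 := rfl

/-- The `n`-th coefficient, as an additive map. -/
def coeffHom (n : ℤ) : PsiDO K →+ Fn K where
  toFun P := P.1 n
  map_zero' := rfl
  map_add' _ _ := rfl

theorem coeff_sum {ι : Type*} (s : Finset ι) (P : ι → PsiDO K) (n : ℤ) :
    (∑ i ∈ s, P i).1 n = ∑ i ∈ s, (P i).1 n := map_sum (coeffHom n) P s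

theorem psido_left_distrib (P Q R : PsiDO K) : P * (Q + R) = P * Q + P * R := by
  refine psido_ext fun n => ?_
  rw [coeff_add, coeff_mul, coeff_mul, coeff_mul, ← finsum_add_distrib
    (finite_mul_support P Q n) (finite_mul_support P R n)]
  refine finsum_congr fun p => ?_
  rw [coeff_add, dx_iterate_add, mul_add, smul_add]

theorem psido_right_distrib (P Q R : PsiDO K) : (P + Q) * R = P * R + Q * R := by
  refine psido_ext fun n => ?_
  rw [coeff_add, coeff_mul, coeff_mul, coeff_mul, ← finsum_add_distrib
    (finite_mul_support P R n) (finite_mul_support Q R n)]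
  refine finsum_congr fun p => ?_
  rw [coeff_add, add_mul, smul_add]

theorem psido_zero_mul (P : PsiDO K) : 0 * P = 0 := by
  have h := psido_right_distrib 0 0 P
  rwa [add_zero, left_eq_add] at h

theorem psido_mul_zero (P : PsiDO K) : P * 0 = 0 := by
  have h := psido_left_distrib P 0 0
  rwa [add_zero, left_eq_add] at h

theorem coeff_mono_mul (f : Fn K) (i : ℕ) (Q : PsiDO K) (n : ℤ) :
    (mono f i * Q).1 n = ∑ k ∈ Finset.range (i + 1),
      Ring.choose (i : ℤ) k • (f * dx^[k] (Q.1 (n - i + k))) := by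
  rw [coeff_mul, finsum_eq_sum_of_support_subset (s := {(i : ℤ)} ×ˢ Finset.range (i + 1)),
    Finset.sum_product, Finset.sum_singleton]
  · refine Finset.sum_congr rfl fun k _ => ?_
    rw [coeff_mono, if_pos rfl]
  · rintro ⟨j, k⟩ h
    have h1 : j = i := by
      by_contra hc
      exact h (by simp [coeff_mono, hc])
    subst h1
    have h2 : k < i + 1 := by
      by_contra hc
      apply h
      simp only
      rw [Ring.choose_natCast, Nat.choose_eq_zero_of_lt (by omega), Nat.cast_zero, zero_smul]
    simpa using Nat.le_of_lt_succ h2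

theorem coeff_fn_mul (f : Fn K) (Q : PsiDO K) (n : ℤ) : (fn f * Q).1 n = f * Q.1 n := by
  have h := coeff_mono_mul f 0 Q n
  simpa [fn] using h

theorem coeff_D_one_mul (Q : PsiDO K) (n : ℤ) :
    (D 1 * Q).1 n = Q.1 (n - 1) + dx (Q.1 n) := by
  have h := coeff_mono_mul 1 1 Q n
  simpa [D, Finset.sum_range_succ] using h

theorem coeff_mul_D (P : PsiDO K) (l n : ℤ) : (P * D l).1 n = P.1 (n - l) := by
  rw [coeff_mul, finsum_eq_single _ (n - l, 0)]
  · simp [D, coeff_mono]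
  · rintro ⟨i, k⟩ h
    simp only [D, coeff_mono]
    split_ifs with h1
    · by_cases hk : k = 0
      · subst hk
        have h2 : i = n - l := by
          simp at h1
          omega
        exact absurd (by rw [h2]) h
      · rw [dx_iterate_one k hk, mul_zero, smul_zero]
    · rw [dx_iterate_zero, mul_zero, smul_zero]

theorem D_mul_D (i j : ℤ) : (D i * D j : PsiDO K) = D (i + j) := by
  refine psido_ext fun n => ?_
  rw [coeff_mul_D]
  simp only [D, coeff_mono, sub_eq_iff_eq_add]

theorem fn_mul_D (f : Fn K) (j : ℤ) : fn f * D j = mono f j := by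
  refine psido_ext fun n => ?_
  rw [coeff_fn_mul]
  simp [D, coeff_mono]

theorem D_zero_mul (P : PsiDO K) : D 0 * P = P :=
  psido_ext fun n => (coeff_fn_mul 1 P n).trans (one_mul _)

theorem mul_D_zero (P : PsiDO K) : P * D 0 = P :=
  psido_ext fun n => by rw [coeff_mul_D, sub_zero]

/-- A derivation applied to all the coefficients of an operator. -/
def mapD (δ : Derivation K (Fn K) (Fn K)) : PsiDO K →+ PsiDO K where
  toFun P := ⟨fun j => δ (P.1 j), by
    obtain ⟨N, hN⟩ := P.2
    exact ⟨N, fun j hj => by simp only [hN j hj, map_zero]⟩⟩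
  map_zero' := psido_ext fun _ => map_zero δ
  map_add' P Q := psido_ext fun j => map_add δ (P.1 j) (Q.1 j)

theorem coeff_mapD (δ : Derivation K (Fn K) (Fn K)) (P : PsiDO K) (n : ℤ) :
    (mapD δ P).1 n = δ (P.1 n) := rfl

theorem deriv_dx_iterate {δ : Derivation K (Fn K) (Fn K)} (hδ : ∀ f, δ (dx f) = dx (δ f))
    (k : ℕ) (f : Fn K) : δ (dx^[k] f) = dx^[k] (δ f) :=
  (Function.Semiconj.iterate_right (f := δ) (ga := dx) (gb := dx) hδ k) f

theorem mapD_mul {δ : Derivation K (Fn K) (Fn K)} (hδ : ∀ f, δ (dx f) = dx (δ f))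
    (P Q : PsiDO K) : mapD δ (P * Q) = mapD δ P * Q + P * mapD δ Q := by
  refine psido_ext fun n => ?_
  obtain ⟨N, hN⟩ := exists_ordLE P
  obtain ⟨M, hM⟩ := exists_ordLE Q
  have hN' : OrdLE (mapD δ P) N := fun j hj => by rw [coeff_mapD, hN j hj, map_zero]
  have hM' : OrdLE (mapD δ Q) M := fun j hj => by rw [coeff_mapD, hM j hj, map_zero]
  have hB : M - n + N < ((M - n + N).toNat + 1 : ℕ) := by omega
  rw [coeff_mapD, coeff_add, coeff_mul_box hN hM le_rfl le_rfl hB,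
    coeff_mul_box hN' hM le_rfl le_rfl hB, coeff_mul_box hN hM' le_rfl le_rfl hB, map_sum,
    ← Finset.sum_add_distrib]
  refine Finset.sum_congr rfl fun i _ => ?_
  rw [map_sum, ← Finset.sum_add_distrib]
  refine Finset.sum_congr rfl fun k _ => ?_
  rw [map_zsmul, Derivation.leibniz, deriv_dx_iterate hδ, coeff_mapD, coeff_mapD, ← smul_add,
    smul_eq_mul, smul_eq_mul, add_comm, mul_comm (dx^[k] _)]

theorem D_one_mul (P : PsiDO K) : D 1 * P = P * D 1 + mapD (MvPowerSeries.pderiv K 1) P :=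
  psido_ext fun n => by
    rw [coeff_D_one_mul, coeff_add, coeff_mul_D]
    rfl

/-- Pascal's rule for the generalized binomial coefficients. Associativity is reduced to this case,
so no Vandermonde-type identity is needed. -/
theorem mul_D_one_mul (P Q : PsiDO K) :
    P * D 1 * Q = P * Q * D 1 + P * mapD (MvPowerSeries.pderiv K 1) Q := by
  refine psido_ext fun n => ?_
  obtain ⟨N, hN⟩ := exists_ordLE P
  obtain ⟨M, hM⟩ := exists_ordLE Q
  set B := (M - n + N).toNat + 1 with hBdef
  have hB : M - n + N < B := by omega
  have hM' : OrdLE (mapD (MvPowerSeries.pderiv K 1) Q) M :=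
    fun j hj => by rw [coeff_mapD, hM j hj, map_zero]
  -- All sums are brought to a common range of `i`: it starts at `n - 1 - M` because `P * Q * D 1`
  -- uses the coefficient of index `n - 1`, and the terms of `P * D 1` are shifted by one.
  rw [coeff_add, coeff_mul_D (P * Q), coeff_mul_box hN hM' (A := n - 1 - M) (by omega) le_rfl hB,
    coeff_mul_box (A := n - 1 - M) (B := B + 1) hN hM le_rfl le_rfl
      (by push_cast; omega), coeff_mul, ← finsum_comp_equiv ((Equiv.addRight (1 : ℤ)).prodCongr
      (Equiv.refl ℕ)), finsum_eq_sum_of_support_subset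
      (s := Finset.Icc (n - 1 - M) N ×ˢ Finset.range (B + 1)), Finset.sum_product,
      ← Finset.sum_add_distrib]
  · refine Finset.sum_congr rfl fun i _ => ?_
    simp only [Equiv.prodCongr_apply, Equiv.coe_addRight, Equiv.coe_refl, Prod.map_apply, id_eq]
    rw [Finset.sum_range_succ', Finset.sum_range_succ' _ B, add_right_comm,
      ← Finset.sum_add_distrib]
    have e : ∀ k : ℕ, n - (i + 1) + k = n - 1 - i + k := fun k => by ring
    simp only [coeff_mul_D, add_sub_cancel_right, e]
    congr 1
    · refine Finset.sum_congr rfl fun k _ => ?_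
      rw [Ring.choose_succ_succ, add_smul, add_comm]
      have e' : n - 1 - i + ((k + 1 : ℕ) : ℤ) = n - i + k := by push_cast; ring
      rw [coeff_mapD, Function.iterate_succ_apply, e']
      rfl
    · simp
  · rintro ⟨i, k⟩ h
    simp only [Function.mem_support, Equiv.prodCongr_apply, Equiv.coe_addRight, Equiv.coe_refl,
      Prod.map_apply, id_eq, coeff_mul_D, add_sub_cancel_right] at h
    have h1 : i ≤ N := by
      by_contra hc
      exact h (by simp [hN i (not_le.mp hc)])
    have h2 : n - (i + 1) + k ≤ M := by
      by_contra hc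
      exact h (by simp only [hM _ (not_le.mp hc), dx_iterate_zero, mul_zero, smul_zero])
    simp only [Finset.coe_product, Set.mem_prod, Finset.mem_coe, Finset.mem_Icc, Finset.mem_range]
    omega

theorem D_one_mul_mul (P Q : PsiDO K) : D 1 * P * Q = D 1 * (P * Q) := by
  rw [D_one_mul, D_one_mul, psido_right_distrib, mul_D_one_mul, mapD_mul fun _ => rfl]
  abel

/-- Once the coefficients above D^j vanish, the D^{j+1}-coefficient of the product is P_j alone, so
the order of P can be lowered indefinitely. This cancellation transfers associativity from D to D⁻¹.
-/
theorem D_one_mul_eq_zero {P : PsiDO K} (h : D 1 * P = 0) : P = 0 := by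
  obtain ⟨N, hN⟩ := exists_ordLE P
  have key : ∀ k : ℕ, OrdLE P (N - k) := by
    intro k
    induction k with
    | zero => simpa using hN
    | succ k ih =>
      intro j hj
      have h1 := coeff_D_one_mul P (j + 1)
      rw [h, coeff_zero, add_sub_cancel_right, ih (j + 1) (by push_cast at hj; omega), dx_zero,
        add_zero] at h1
      exact h1.symm
  exact psido_ext fun n => key (N - n + 1).toNat n (by omega)

theorem psido_mul_sub (P Q R : PsiDO K) : P * (Q - R) = P * Q - P * R := by
  rw [eq_sub_iff_add_eq, ← psido_left_distrib, sub_add_cancel]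

theorem D_neg_one_mul_mul (P Q : PsiDO K) : D (-1) * P * Q = D (-1) * (P * Q) := by
  have h : ∀ P : PsiDO K, D 1 * (D (-1) * P) = P := fun P => by
    rw [← D_one_mul_mul, D_mul_D, add_neg_cancel, D_zero_mul]
  rw [← sub_eq_zero]
  apply D_one_mul_eq_zero
  rw [psido_mul_sub, ← D_one_mul_mul, h, h, sub_self]

/-- Multiplication from the left by `P` is associative. -/
def AssocLeft (P : PsiDO K) : Prop := ∀ Q R, P * Q * R = P * (Q * R)

theorem AssocLeft.mul {P Q : PsiDO K} (hP : AssocLeft P) (hQ : AssocLeft Q) :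
    AssocLeft (P * Q) := fun R S => by rw [hP, hP, hQ, hP]

theorem AssocLeft.add {P Q : PsiDO K} (hP : AssocLeft P) (hQ : AssocLeft Q) :
    AssocLeft (P + Q) := fun R S => by simp only [psido_right_distrib, hP R S, hQ R S]

theorem assocLeft_zero : AssocLeft (0 : PsiDO K) := fun R S => by simp only [psido_zero_mul]

theorem assocLeft_sum {ι : Type*} (s : Finset ι) (P : ι → PsiDO K) (h : ∀ i ∈ s, AssocLeft (P i)) :
    AssocLeft (∑ i ∈ s, P i) :=
  Finset.sum_induction P AssocLeft (fun _ _ => AssocLeft.add) assocLeft_zero h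

theorem assocLeft_fn (f : Fn K) : AssocLeft (fn f) := fun Q R => by
  refine psido_ext fun n => ?_
  rw [coeff_fn_mul, coeff_mul, coeff_mul]
  refine .trans ?_ (mul_finsum' _ f (finite_mul_support Q R n)).symm
  refine finsum_congr fun p => ?_
  rw [coeff_fn_mul, mul_smul_comm, mul_assoc]

theorem assocLeft_D (n : ℤ) : AssocLeft (D n : PsiDO K) := by
  induction n with
  | zero => exact assocLeft_fn 1
  | succ n ih => exact D_mul_D (K := K) n 1 ▸ ih.mul D_one_mul_mul
  | pred n ih => exact D_mul_D (K := K) (-n) (-1) ▸ ih.mul D_neg_one_mul_mul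

/-- A given coefficient of a triple product sees only finitely many coefficients of P. The
truncation is a finite sum of f D^j, for which associativity is known. -/
theorem psido_mul_assoc (P Q R : PsiDO K) : P * Q * R = P * (Q * R) := by
  refine psido_ext fun n => ?_
  obtain ⟨N, hN⟩ := exists_ordLE P
  obtain ⟨M, hM⟩ := exists_ordLE Q
  obtain ⟨M', hM'⟩ := exists_ordLE R
  -- The tail of P below D^c has order at most c - 1, so its products with Q and R have order at
  -- most n - 1.
  set c := n - M - M'
  set H : PsiDO K := ∑ j ∈ Finset.Icc c N, mono (P.1 j) j with hH
  have h1 : AssocLeft H := assocLeft_sum _ _ fun j _ =>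
    fn_mul_D (P.1 j) j ▸ (assocLeft_fn _).mul (assocLeft_D j)
  have h2 : OrdLE (P - H) (c - 1) := by
    intro j hj
    rw [coeff_sub, hH, coeff_sum]
    simp only [coeff_mono, Finset.sum_ite_eq, Finset.mem_Icc]
    split_ifs with h
    · exact sub_self _
    · rw [hN j (by omega), sub_zero]
  rw [← sub_add_cancel P H, psido_right_distrib, psido_right_distrib, psido_right_distrib,
    coeff_add, coeff_add, h1, (h2.mul hM).mul hM' n (by omega),
    h2.mul (hM.mul hM') n (by omega)]

instance : Ring (PsiDO K) :=
  { (inferInstance : AddCommGroup (PsiDO K)) with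
    mul := (· * ·)
    one := D 0
    left_distrib := psido_left_distrib
    right_distrib := psido_right_distrib
    zero_mul := psido_zero_mul
    mul_zero := psido_mul_zero
    mul_assoc := psido_mul_assoc
    one_mul := D_zero_mul
    mul_one := mul_D_zero }

theorem D_zero : (D 0 : PsiDO K) = 1 := rfl

theorem fn_one : (fn 1 : PsiDO K) = 1 := rfl

/-! ### Action of differential operators on functions -/

theorem coeff_fn (f : Fn K) (n : ℤ) : (fn f).1 n = if n = 0 then f else 0 := rfl

theorem fn_mul_fn (f g : Fn K) : fn f * fn g = fn (f * g) :=
  psido_ext fun n => by simp [coeff_fn_mul, coeff_fn]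

theorem fn_add (f g : Fn K) : fn (f + g) = fn f + fn g :=
  psido_ext fun n => by simp only [coeff_add, coeff_fn]; split_ifs <;> simp

theorem fn_zero : fn (0 : Fn K) = 0 :=
  psido_ext fun n => by simp [coeff_fn, coeff_zero]

/-- `fn` as an additive map. -/
def fnHom : Fn K →+ PsiDO K where
  toFun := fn
  map_zero' := fn_zero
  map_add' := fn_add

theorem fn_neg (f : Fn K) : fn (-f) = -fn f := map_neg fnHom f

theorem fn_sub (f g : Fn K) : fn (f - g) = fn f - fn g := map_sub fnHom f g

theorem fn_sum {ι : Type*} (s : Finset ι) (f : ι → Fn K) :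
    fn (∑ i ∈ s, f i) = ∑ i ∈ s, fn (f i) := map_sum fnHom f s

theorem D_one_mul_D_neg_one : (D 1 * D (-1) : PsiDO K) = 1 := D_mul_D 1 (-1)

theorem D_neg_one_mul_D_one : (D (-1) * D 1 : PsiDO K) = 1 := D_mul_D (-1) 1

theorem mapD_fn (δ : Derivation K (Fn K) (Fn K)) (f : Fn K) : mapD δ (fn f) = fn (δ f) :=
  psido_ext fun n => by
    rw [coeff_mapD, coeff_fn, coeff_fn]
    split_ifs
    · rfl
    · exact map_zero δ

theorem mapD_D (δ : Derivation K (Fn K) (Fn K)) (j : ℤ) : mapD δ (D j) = 0 :=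
  psido_ext fun n => by
    rw [coeff_mapD, D, coeff_mono, coeff_zero]
    split_ifs
    · exact δ.map_one_eq_zero
    · exact map_zero δ

theorem D_one_mul_fn (f : Fn K) : D 1 * fn f = fn f * D 1 + fn (dx f) := by
  rw [D_one_mul, mapD_fn]
  rfl

theorem D_one_fn_D_neg_one (f : Fn K) : D 1 * fn f * D (-1) = fn f + fn (dx f) * D (-1) := by
  rw [D_one_mul_fn, add_mul, mul_assoc, D_one_mul_D_neg_one, mul_one]

theorem D_neg_one_fn_dx_D_neg_one (f : Fn K) :
    D (-1) * fn (dx f) * D (-1) = fn f * D (-1) - D (-1) * fn f := by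
  rw [← add_sub_cancel_left (fn f * D 1) (fn (dx f)), ← D_one_mul_fn, mul_sub, sub_mul,
    ← mul_assoc, D_neg_one_mul_D_one, one_mul, mul_assoc, mul_assoc, D_one_mul_D_neg_one, mul_one]

theorem act_eq_sum {P : PsiDO K} {N : ℕ} (hP : OrdLE P N) (f : Fn K) :
    act P f = ∑ j ∈ Finset.range (N + 1), P.1 j * dx^[j] f := by
  refine finsum_eq_sum_of_support_subset _ fun j h => ?_
  by_contra hc
  have : (N : ℤ) < j := by
    simp only [Finset.coe_range, Set.mem_Iio] at hc
    omega
  exact h (by simp [hP j this])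

theorem exists_ordLE_nat (P : PsiDO K) : ∃ N : ℕ, OrdLE P N := by
  obtain ⟨N, hN⟩ := exists_ordLE P
  exact ⟨N.toNat, hN.mono (Int.self_le_toNat N)⟩

theorem act_eq_coeff (P : PsiDO K) (f : Fn K) : act P f = (P * fn f).1 0 := by
  obtain ⟨N, hN⟩ := exists_ordLE_nat P
  rw [act_eq_sum hN, coeff_mul, finsum_eq_sum_of_support_subset
    (s := (Finset.range (N + 1)).image fun j : ℕ => ((j : ℤ), j)), Finset.sum_image]
  · refine Finset.sum_congr rfl fun j _ => ?_
    simp [coeff_fn, Ring.choose_natCast]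
  · intro i _ j _ h
    exact (Prod.ext_iff.mp h).2
  · rintro ⟨i, k⟩ h
    have h1 : i = k := by
      by_contra hc
      refine h ?_
      simp only
      rw [coeff_fn, if_neg (by omega), dx_iterate_zero, mul_zero, smul_zero]
    subst h1
    have h2 : k ≤ N := by
      by_contra hc
      exact h (by simp [hN k (by omega)])
    simp
    omega

/-- `P` is a differential operator. -/
def IsDiff (P : PsiDO K) : Prop := ∀ j, j < 0 → P.1 j = 0

theorem IsDiff.add {P Q : PsiDO K} (hP : IsDiff P) (hQ : IsDiff Q) : IsDiff (P + Q) :=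
  fun j hj => by rw [coeff_add, hP j hj, hQ j hj, add_zero]

theorem IsDiff.sub {P Q : PsiDO K} (hP : IsDiff P) (hQ : IsDiff Q) : IsDiff (P - Q) :=
  fun j hj => by rw [coeff_sub, hP j hj, hQ j hj, sub_zero]

theorem isDiff_fn (f : Fn K) : IsDiff (fn f) := fun _ hj => if_neg hj.ne

theorem isDiff_D_one : IsDiff (D 1 : PsiDO K) := fun j hj => if_neg (by omega)

theorem IsDiff.mul {P Q : PsiDO K} (hP : IsDiff P) (hQ : IsDiff Q) : IsDiff (P * Q) := by
  intro n hn
  rw [coeff_mul]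
  refine finsum_eq_zero_of_forall_eq_zero ?_
  rintro ⟨i, k⟩
  rcases lt_or_ge i 0 with hi | hi
  · simp [hP i hi]
  rcases lt_or_ge (n - i + k) 0 with hk | hk
  · simp only [hQ _ hk, dx_iterate_zero, mul_zero, smul_zero]
  · lift i to ℕ using hi
    simp only
    rw [Ring.choose_natCast, Nat.choose_eq_zero_of_lt (by omega), Nat.cast_zero, zero_smul]

theorem isDiff_mul_D_neg_one {P : PsiDO K} (hP : IsDiff P) (h : P.1 0 = 0) :
    IsDiff (P * D (-1)) := by
  intro j hj
  rw [coeff_mul_D]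
  rcases eq_or_ne (j - -1) 0 with h0 | h0
  · rw [h0, h]
  · exact hP _ (by omega)

/-- Q f and the function Q(f) differ by an operator without zeroth coefficient, hence by a
differential operator times D. This remainder still has no zeroth coefficient after multiplication
by P. -/
theorem act_mul {P Q : PsiDO K} (hP : IsDiff P) (hQ : IsDiff Q) (f : Fn K) :
    act (P * Q) f = act P (act Q f) := by
  set R := Q * fn f - fn (act Q f) with hR
  have hdiff : IsDiff (P * (R * D (-1))) := by
    refine hP.mul (isDiff_mul_D_neg_one ((hQ.mul (isDiff_fn f)).sub (isDiff_fn _)) ?_)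
    rw [coeff_sub, coeff_fn, if_pos rfl, ← act_eq_coeff, sub_self]
  have h : P * Q * fn f = P * fn (act Q f) + P * (R * D (-1)) * D 1 := by
    simp only [mul_assoc, D_neg_one_mul_D_one, mul_one, ← mul_add]
    rw [hR, add_sub_cancel]
  rw [act_eq_coeff, h, coeff_add, coeff_mul_D, hdiff _ (by omega), add_zero, ← act_eq_coeff]

theorem act_fn (f g : Fn K) : act (fn f) g = f * g := by
  rw [act_eq_coeff, coeff_fn_mul, coeff_fn, if_pos rfl]

theorem act_add (P Q : PsiDO K) (f : Fn K) : act (P + Q) f = act P f + act Q f := by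
  simp only [act_eq_coeff, add_mul, coeff_add]

theorem act_sub (P Q : PsiDO K) (f : Fn K) : act (P - Q) f = act P f - act Q f := by
  simp only [act_eq_coeff, sub_mul, coeff_sub]

theorem act_add_right (P : PsiDO K) (f g : Fn K) : act P (f + g) = act P f + act P g := by
  simp only [act_eq_coeff, fn_add, mul_add, coeff_add]

theorem act_D_one (f : Fn K) : act (D 1) f = dx f := by
  rw [act_eq_coeff, coeff_D_one_mul, coeff_fn, coeff_fn, if_neg (by omega), if_pos rfl, zero_add]

theorem act_congr {P Q : PsiDO K} (h : ∀ j, 0 ≤ j → P.1 j = Q.1 j) (f : Fn K) :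
    act P f = act Q f := by
  refine finsum_congr fun j => ?_
  rw [h j (by omega)]

theorem coeff_negPart (A : ℤ → Fn K) (j : ℤ) : (negPart A).1 j = if j < 0 then A j else 0 := rfl

theorem isDiff_sub_negPart (P : PsiDO K) : IsDiff (P - negPart P.1) := fun j hj => by
  rw [coeff_sub, coeff_negPart, if_pos hj, sub_self]

theorem ordLE_negPart (A : ℤ → Fn K) : OrdLE (negPart A) (-1) := fun j hj => if_neg (by omega)

theorem negPart_eq_self {P : PsiDO K} (h : OrdLE P (-1)) : negPart P.1 = P :=
  psido_ext fun j => by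
    rw [coeff_negPart]
    split_ifs with hj
    · rfl
    · exact (h j (by omega)).symm

theorem negPart_add (P Q : PsiDO K) : negPart (P + Q).1 = negPart P.1 + negPart Q.1 :=
  psido_ext fun j => by
    simp only [coeff_add, coeff_negPart]
    split_ifs <;> simp

theorem negPart_eq_zero {P : PsiDO K} (h : IsDiff P) : negPart P.1 = 0 :=
  psido_ext fun j => by
    rw [coeff_negPart]
    split_ifs with hj
    · exact h j hj
    · rfl

theorem ordLE_fn (f : Fn K) : OrdLE (fn f) 0 := fun _ hj => if_neg hj.ne'

theorem ordLE_D (n : ℤ) : OrdLE (D n : PsiDO K) n := fun _ hj => if_neg hj.ne'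

theorem OrdLE.sum {ι : Type*} {s : Finset ι} {P : ι → PsiDO K} {N : ℤ}
    (h : ∀ i ∈ s, OrdLE (P i) N) : OrdLE (∑ i ∈ s, P i) N := fun j hj => by
  rw [coeff_sum]
  exact Finset.sum_eq_zero fun i hi => h i hi j hj

/-- The operator `∑ Φ_i D⁻¹ Ψ_i`. -/
def kernelOp {m : ℕ} (Φ Ψ : Fin m → Fn K) : PsiDO K := ∑ i, fn (Φ i) * D (-1) * fn (Ψ i)

theorem ordLE_kernelOp {m : ℕ} (Φ Ψ : Fin m → Fn K) : OrdLE (kernelOp Φ Ψ) (-1) :=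
  OrdLE.sum fun i _ => ((ordLE_fn (Φ i)).mul (ordLE_D (-1))).mul (ordLE_fn (Ψ i))

/-! ### The Darboux–Bäcklund transformation -/

theorem dx_sum {ι : Type*} (s : Finset ι) (f : ι → Fn K) :
    dx (∑ i ∈ s, f i) = ∑ i ∈ s, dx (f i) := map_sum (MvPowerSeries.pderiv K 1) f s

theorem dx_neg (f : Fn K) : dx (-f) = -dx f := map_neg (MvPowerSeries.pderiv K 1) f

theorem dx_sub (f g : Fn K) : dx (f - g) = dx f - dx g := map_sub (MvPowerSeries.pderiv K 1) f g

theorem mul_inv_of_isUnit {f : Fn K} (h : IsUnit f) : f * f⁻¹ = 1 :=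
  MvPowerSeries.mul_inv_cancel f (MvPowerSeries.isUnit_iff_constantCoeff.mp h).ne_zero

section DarbouxStep

variable {m : ℕ} {a : Fin m} {L L' : PsiDO K} {Φ Ψ S Φ' Ψ' : Fin m → Fn K}

/-- T kills its generator, so the rule Φ'_i = T(Φ_i) may be used for every i, with one correction
term at i = a. The sums over i then need no splitting. -/
theorem IsDBStep.phi_eq (h : IsDBStep a L Φ Ψ S L' Φ' Ψ') (i : Fin m) :
    Φ' i = Φ a * dx ((Φ a)⁻¹ * Φ i) + if i = a then
      Φ a * dx ((Φ a)⁻¹ * (act L (Φ a) + ∑ j, Φ j * S j)) else 0 := by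
  split_ifs with hi
  · subst hi
    rw [mul_comm (Φ i)⁻¹ (Φ i), mul_inv_of_isUnit h.isUnit, dx_one, mul_zero, zero_add, h.phi_gen]
  · rw [h.phi i hi, add_zero]

theorem IsDBStep.kernel_term (h : IsDBStep a L Φ Ψ S L' Φ' Ψ') (i : Fin m) :
    fn (Φ' i) * D (-1) * fn (Ψ' i) =
      -(fn (Φ a) * fn (dx ((Φ a)⁻¹ * Φ i)) * D (-1) * fn (S i) * fn (Φ a)⁻¹) + if i = a then
        fn (Φ a) * fn (dx ((Φ a)⁻¹ * (act L (Φ a) + ∑ j, Φ j * S j))) * D (-1) * fn (Φ a)⁻¹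
        else 0 := by
  split_ifs with hi
  · subst hi
    rw [mul_comm (Φ i)⁻¹ (Φ i), mul_inv_of_isUnit h.isUnit, dx_one, fn_zero, h.phi_gen, h.psi_gen,
      fn_mul_fn]
    simp
  · rw [h.phi i hi, h.psi i hi, add_zero, mul_comm (Φ a)⁻¹ (S i), fn_neg, ← fn_mul_fn,
      ← fn_mul_fn]
    simp only [mul_neg, mul_assoc]

/-- Integration by parts: D⁻¹ s' D⁻¹ = s D⁻¹ - D⁻¹ s, applied to s' = gφ. -/
theorem conj_kernel_term {φ φi f g s : Fn K} (hs : dx s = g * φ) :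
    fn φ * D 1 * fn φi * (fn f * D (-1) * fn g) * (fn φ * D (-1) * fn φi) =
      fn φ * fn (dx (φi * (f * s))) * D (-1) * fn φi -
        fn φ * fn (dx (φi * f)) * D (-1) * fn s * fn φi := by
  have e1 : fn φ * D 1 * fn φi * (fn f * D (-1) * fn g) * (fn φ * D (-1) * fn φi) =
      fn φ * (D 1 * (fn φi * fn f) * (D (-1) * (fn g * fn φ) * D (-1))) * fn φi := by
    simp only [mul_assoc]
  have e2 : D 1 * fn (φi * f) * (fn s * D (-1) - D (-1) * fn s) =
      fn (dx (φi * (f * s))) * D (-1) - fn (dx (φi * f)) * D (-1) * fn s := by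
    rw [mul_sub, ← mul_assoc, ← mul_assoc, D_one_fn_D_neg_one, mul_assoc (D 1), fn_mul_fn,
      D_one_fn_D_neg_one, add_mul, fn_mul_fn, mul_assoc φi]
    abel
  rw [e1, fn_mul_fn, fn_mul_fn, ← hs, D_neg_one_fn_dx_D_neg_one, e2]
  simp only [mul_sub, sub_mul, mul_assoc]

/-- The differential part of the transformed Lax operator. -/
theorem IsDBStep.exists_decomposition (h : IsDBStep a L Φ Ψ S L' Φ' Ψ')
    (hL : negPart L.1 = kernelOp Φ Ψ) :
    ∃ C : PsiDO K, IsDiff C ∧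
      C * D 1 = fn (Φ a)⁻¹ * (L - negPart L.1) * fn (Φ a) - fn ((Φ a)⁻¹ * act L (Φ a)) ∧
      L' = fn (Φ a) * (D 1 * C + fn ((Φ a)⁻¹ * act L (Φ a))) * fn (Φ a)⁻¹ + kernelOp Φ' Ψ' := by
  set φ := Φ a
  set B0 := φ⁻¹ * act L φ with hB0
  set A := L - negPart L.1 with hA
  set R := fn φ⁻¹ * A * fn φ - fn B0 with hR
  have hAdiff : IsDiff A := isDiff_sub_negPart L
  have hactA : act A φ = act L φ := act_congr (fun j hj => by
    rw [hA, coeff_sub, coeff_negPart, if_neg (by omega), sub_zero]) φ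
  -- R annihilates the function 1, so it is right divisible by D among differential operators; the
  -- quotient is the witness C.
  have hR0 : R.1 0 = 0 := by
    rw [hR, coeff_sub, mul_assoc, coeff_fn_mul, ← act_eq_coeff, hactA, coeff_fn, if_pos rfl,
      sub_self]
  have hRC : R * D (-1) * D 1 = R := by rw [mul_assoc, D_neg_one_mul_D_one, mul_one]
  refine ⟨R * D (-1), isDiff_mul_D_neg_one
    ((((isDiff_fn _).mul hAdiff).mul (isDiff_fn _)).sub (isDiff_fn _)) hR0, hRC, ?_⟩
  have hLA : L = A + ∑ i, fn (Φ i) * D (-1) * fn (Ψ i) := by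
    rw [hA, hL, kernelOp, sub_add_cancel]
  -- The nonlocal leftover φ B0' D⁻¹ φ⁻¹ joins the first terms of `conj_kernel_term` to form Φ'_a
  -- D⁻¹ Ψ'_a.
  have e1 : fn φ * D 1 * fn φ⁻¹ * A * (fn φ * D (-1) * fn φ⁻¹) =
      fn φ * (D 1 * (R * D (-1)) + fn B0) * fn φ⁻¹ +
        fn φ * fn (dx B0) * D (-1) * fn φ⁻¹ := by
    have e2 : fn φ * D 1 * fn φ⁻¹ * A * (fn φ * D (-1) * fn φ⁻¹) =
        fn φ * (D 1 * (fn φ⁻¹ * A * fn φ) * D (-1)) * fn φ⁻¹ := by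
      simp only [mul_assoc]
    have e3 : fn φ⁻¹ * A * fn φ = R + fn B0 := by rw [hR, sub_add_cancel]
    rw [e2, e3, mul_add, add_mul, D_one_fn_D_neg_one]
    simp only [mul_add, add_mul, mul_assoc]
    abel
  rw [h.lax, hLA, mul_add, add_mul, e1, add_assoc]
  congr 1
  rw [kernelOp, Finset.sum_congr rfl fun i _ => h.kernel_term i, Finset.sum_add_distrib,
    Finset.sum_ite_eq', if_pos (Finset.mem_univ a), mul_add φ⁻¹, dx_add, fn_add,
    Finset.mul_sum, Finset.sum_mul, Finset.sum_congr rfl fun i _ =>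
      conj_kernel_term (h.antideriv i),
    Finset.sum_sub_distrib, Finset.mul_sum, dx_sum, fn_sum]
  simp only [mul_add, add_mul, Finset.mul_sum, Finset.sum_mul, Finset.sum_neg_distrib]
  rw [← hB0]
  abel

theorem IsDBStep.negPart_eq (h : IsDBStep a L Φ Ψ S L' Φ' Ψ') (hL : negPart L.1 = kernelOp Φ Ψ) :
    negPart L'.1 = kernelOp Φ' Ψ' := by
  obtain ⟨C, hC, -, h1⟩ := h.exists_decomposition hL
  rw [h1, negPart_add, negPart_eq_self (ordLE_kernelOp Φ' Ψ'), negPart_eq_zero, zero_add]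
  exact ((isDiff_fn _).mul ((isDiff_D_one.mul hC).add (isDiff_fn _))).mul (isDiff_fn _)

/-- Applying C to (φ⁻¹f)' is applying C D to φ⁻¹f, and C D is known from
`IsDBStep.exists_decomposition`; the kernel part has no nonnegative coefficients. -/
theorem IsDBStep.act_eq (h : IsDBStep a L Φ Ψ S L' Φ' Ψ') (hL : negPart L.1 = kernelOp Φ Ψ)
    (f : Fn K) : act L' (Φ a * dx ((Φ a)⁻¹ * f)) =
      Φ a * (dx ((Φ a)⁻¹ * act L f) - dx ((Φ a)⁻¹ * act L (Φ a)) * ((Φ a)⁻¹ * f)) := by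
  obtain ⟨C, hC, hCD, h1⟩ := h.exists_decomposition hL
  have hφ : Φ a * (Φ a)⁻¹ = 1 := mul_inv_of_isUnit h.isUnit
  set φ := Φ a
  set v := φ⁻¹ * f with hv
  set B0 := φ⁻¹ * act L φ
  have hf : φ * v = f := by rw [hv, ← mul_assoc, hφ, one_mul]
  have hk : act (kernelOp Φ' Ψ') (φ * dx v) = 0 :=
    finsum_eq_zero_of_forall_eq_zero fun j => by
      rw [ordLE_kernelOp Φ' Ψ' j (by omega), zero_mul]
  have hd := (isDiff_D_one.mul hC).add (isDiff_fn B0)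
  have hactA : act (L - negPart L.1) f = act L f := act_congr (fun j hj => by
    rw [coeff_sub, coeff_negPart, if_neg (by omega), sub_zero]) f
  have hCv : act C (dx v) = φ⁻¹ * act L f - B0 * v := by
    rw [← act_D_one, ← act_mul hC isDiff_D_one, hCD, act_sub, act_fn,
      act_mul ((isDiff_fn _).mul (isDiff_sub_negPart L)) (isDiff_fn _), act_fn, hf,
      act_mul (isDiff_fn _) (isDiff_sub_negPart L), act_fn, hactA]
  rw [h1, act_add, hk, add_zero, act_mul ((isDiff_fn _).mul hd) (isDiff_fn _),
    act_mul (isDiff_fn _) hd, act_fn, act_fn, ← mul_assoc, mul_comm φ⁻¹ φ, hφ, one_mul, act_add,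
    act_mul isDiff_D_one hC, act_D_one, act_fn, hCv, dx_sub, dx_mul B0]
  ring

/-- `T = Φ_a D Φ_a⁻¹` intertwines the actions of `L` and `L' = T L T⁻¹`. -/
theorem IsDBStep.laxActs (h : IsDBStep a L Φ Ψ S L' Φ' Ψ') (hL : negPart L.1 = kernelOp Φ Ψ)
    {f g : Fn K} (hfg : LaxActs L Φ Ψ f g) :
    LaxActs L' Φ' Ψ' (Φ a * dx ((Φ a)⁻¹ * f)) (Φ a * dx ((Φ a)⁻¹ * g)) := by
  obtain ⟨F, hF, rfl⟩ := hfg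
  have hφ : Φ a * (Φ a)⁻¹ = 1 := mul_inv_of_isUnit h.isUnit
  have hS := h.antideriv
  -- These are antiderivatives of Ψ'_j T(f): for j = a the integrand is (φ⁻¹f)' with φ = Φ_a, and
  -- for j ≠ a it is -S_j (φ⁻¹f)', integrated by parts using S_j' = Ψ_j φ and F_j' = Ψ_j f.
  refine ⟨fun j => if j = a then (Φ a)⁻¹ * f else F j - S j * ((Φ a)⁻¹ * f), fun j => ?_, ?_⟩
  · simp only
    split_ifs with hj
    · subst hj
      rw [h.psi_gen, ← mul_assoc, mul_comm (Φ j)⁻¹ (Φ j), hφ, one_mul]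
    · rw [h.psi j hj, dx_sub, dx_mul (S j), hF, hS]
      linear_combination (-(Ψ j * f) + S j * dx ((Φ a)⁻¹ * f)) * hφ
  · have key : ∀ j, Φ' j * (if j = a then (Φ a)⁻¹ * f else F j - S j * ((Φ a)⁻¹ * f)) =
        Φ a * dx ((Φ a)⁻¹ * Φ j) * (F j - S j * ((Φ a)⁻¹ * f)) + if j = a then
          Φ a * dx ((Φ a)⁻¹ * (act L (Φ a) + ∑ j, Φ j * S j)) * ((Φ a)⁻¹ * f) else 0 := by
      intro j
      rw [h.phi_eq j]
      split_ifs with hj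
      · subst hj
        rw [mul_comm (Φ j)⁻¹ (Φ j), hφ, dx_one]
        ring
      · ring
    rw [h.act_eq hL, Finset.sum_congr rfl fun j _ => key j, Finset.sum_add_distrib,
      Finset.sum_ite_eq', if_pos (Finset.mem_univ a), mul_add (Φ a)⁻¹, mul_add (Φ a)⁻¹, dx_add,
      dx_add, Finset.mul_sum, Finset.mul_sum, dx_sum, dx_sum]
    have e1 : ∀ j, dx ((Φ a)⁻¹ * (Φ j * F j)) =
        dx ((Φ a)⁻¹ * Φ j) * F j + (Φ a)⁻¹ * Φ j * Ψ j * f := fun j => by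
      rw [← mul_assoc, dx_mul _ (F j), hF]
      ring
    have e2 : ∀ j, dx ((Φ a)⁻¹ * (Φ j * S j)) =
        dx ((Φ a)⁻¹ * Φ j) * S j + (Φ a)⁻¹ * Φ j * Ψ j * Φ a := fun j => by
      rw [← mul_assoc, dx_mul _ (S j), hS]
      ring
    rw [Finset.sum_congr rfl fun j _ => e1 j, Finset.sum_congr rfl fun j _ => e2 j,
      Finset.sum_add_distrib, Finset.sum_add_distrib, ← Finset.sum_mul, ← Finset.sum_mul]
    simp only [mul_sub, Finset.sum_sub_distrib, ← mul_assoc, ← Finset.sum_mul]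
    simp only [mul_assoc (Φ a), ← Finset.mul_sum]
    linear_combination (-(Φ a * ∑ i, (Φ a)⁻¹ * Φ i * Ψ i) * f) * hφ

end DarbouxStep

/-! ### Wronskians -/

/-- For the determinant only the triangular shape and the diagonal entry φ matter, so the binomial
coefficients are left implicit. -/
theorem exists_leibniz (φ : Fn K) (i : ℕ) : ∃ c : ℕ → Fn K, c i = φ ∧ (∀ k, i < k → c k = 0) ∧
    ∀ g, dx^[i] (φ * g) = ∑ k ∈ Finset.range (i + 1), c k * dx^[k] g := by
  induction i with
  | zero => exact ⟨fun k => if k = 0 then φ else 0, rfl, fun k hk => if_neg hk.ne', by simp⟩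
  | succ i ih =>
    obtain ⟨c, h1, h2, h3⟩ := ih
    refine ⟨fun k => dx (c k) + if k = 0 then 0 else c (k - 1), ?_, fun k hk => ?_, fun g => ?_⟩
    · simp [h1, h2 (i + 1) (by omega), dx_zero]
    · simp only
      rw [h2 k (by omega), h2 (k - 1) (by omega), dx_zero, ite_self, add_zero]
    · rw [Function.iterate_succ_apply', h3, dx_sum]
      simp only [dx_mul, add_mul, Finset.sum_add_distrib, ← Function.iterate_succ_apply' dx]
      rw [Finset.sum_range_succ (fun k => dx (c k) * dx^[k] g) (i + 1), h2 (i + 1) (by omega),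
        dx_zero, zero_mul, add_zero,
        Finset.sum_range_succ' (fun k => (if k = 0 then 0 else c (k - 1)) * dx^[k] g)]
      simp

theorem wronskian_mul (n : ℕ) (φ : Fn K) (f : ℕ → Fn K) :
    wronskian n (fun k => φ * f k) = φ ^ n * wronskian n f := by
  choose c h1 h2 h3 using exists_leibniz φ
  have hmat : (Matrix.of fun i j : Fin n => dx^[(i : ℕ)] (φ * f j)) =
      (Matrix.of fun i k : Fin n => c i k) * Matrix.of fun i j : Fin n => dx^[(i : ℕ)] (f j) := by
    ext1 i j
    rw [Matrix.mul_apply]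
    simp only [Matrix.of_apply]
    rw [h3, Fin.sum_univ_eq_sum_range (fun k => c i k * dx^[k] (f j)) n]
    refine Finset.sum_subset (by simp [Finset.range_subset_range]) fun k _ hk => ?_
    rw [h2 i k (by simpa using hk), zero_mul]
  rw [wronskian, hmat, Matrix.det_mul, Matrix.det_of_isLowerTriangular, wronskian]
  · simp [h1]
  · intro i j hij
    exact h2 i j hij

theorem wronskian_one_cons (n : ℕ) (f : ℕ → Fn K) (h : f 0 = 1) :
    wronskian (n + 1) f = wronskian n fun k => dx (f (k + 1)) := by
  rw [wronskian, Matrix.det_succ_column_zero, Fin.sum_univ_succ, Finset.sum_eq_zero, wronskian]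
  · simp only [Fin.val_zero, pow_zero, Matrix.of_apply, Function.iterate_zero, id_eq, h, one_mul,
      add_zero]
    congr 1
  · intro i _
    simp only [Matrix.of_apply, Fin.val_zero, h, Fin.val_succ]
    rw [dx_iterate_one _ (Nat.succ_ne_zero _), mul_zero, zero_mul]

/-- Crum's reduction of a Wronskian by the transformation generated by its first entry. -/
theorem wronskian_succ (n : ℕ) (f : ℕ → Fn K) (h : IsUnit (f 0)) :
    wronskian (n + 1) f =
      f 0 * wronskian n fun k => f 0 * dx ((f 0)⁻¹ * f (k + 1)) := by
  have e : f = fun k => f 0 * ((f 0)⁻¹ * f k) := by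
    funext k
    rw [← mul_assoc, mul_inv_of_isUnit h, one_mul]
  conv_lhs => rw [e]
  rw [wronskian_mul, wronskian_one_cons n _ (by rw [mul_comm, mul_inv_of_isUnit h]),
    wronskian_mul n (f 0)]
  ring

/-! ### Spans over the functions that do not depend on `x` -/

variable (K) in
/-- The functions that do not depend on `x`. -/
def xconst : Subring (Fn K) where
  carrier := {c | dx c = 0}
  zero_mem' := dx_zero
  one_mem' := dx_one
  add_mem' {a b} ha hb := by
    change dx (a + b) = 0
    rw [dx_add, ha, hb, add_zero]
  neg_mem' {a} ha := by
    change dx (-a) = 0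
    rw [dx_neg, ha, neg_zero]
  mul_mem' {a b} ha hb := by
    change dx (a * b) = 0
    rw [dx_mul, ha, hb, zero_mul, mul_zero, add_zero]

theorem dx_xconst_mul (c : xconst K) (f : Fn K) : dx (c.1 * f) = c.1 * dx f := by
  rw [dx_mul, show dx c.1 = 0 from c.2, zero_mul, zero_add]

/-- The span of `f 0, …, f (k - 1)`. -/
def lowerSpan (f : ℕ → Fn K) (k : ℕ) : Submodule (xconst K) (Fn K) :=
  Submodule.span (xconst K) (f '' Set.Iio k)

theorem mem_lowerSpan (f : ℕ → Fn K) {i k : ℕ} (h : i < k) : f i ∈ lowerSpan f k :=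
  Submodule.subset_span ⟨i, h, rfl⟩

theorem lowerSpan_mono (f : ℕ → Fn K) {i k : ℕ} (h : i ≤ k) : lowerSpan f i ≤ lowerSpan f k :=
  Submodule.span_mono (Set.image_mono (Set.Iio_subset_Iio h))

theorem lowerSpan_zero (f : ℕ → Fn K) : lowerSpan f 0 = ⊥ := by
  rw [lowerSpan, show Set.Iio 0 = (∅ : Set ℕ) from Set.Iio_bot, Set.image_empty,
    Submodule.span_empty]

/-- The operator `T = φ D φ⁻¹`. -/
def darboux (φ : Fn K) : Fn K →ₗ[xconst K] Fn K where
  toFun f := φ * dx (φ⁻¹ * f)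
  map_add' f g := by rw [mul_add, dx_add, mul_add]
  map_smul' c f := by
    change φ * dx (φ⁻¹ * (c.1 * f)) = c.1 * (φ * dx (φ⁻¹ * f))
    rw [mul_left_comm, dx_xconst_mul, mul_left_comm]

theorem darboux_apply (φ f : Fn K) : darboux φ f = φ * dx (φ⁻¹ * f) := rfl

theorem darboux_self {φ : Fn K} (h : IsUnit φ) : darboux φ φ = 0 := by
  rw [darboux_apply, mul_comm φ⁻¹, mul_inv_of_isUnit h, dx_one, mul_zero]

/-- T annihilates f_0 and is linear over x-independent functions, so the flag of spans loses its
first step. -/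
theorem darboux_mem_lowerSpan {f : ℕ → Fn K} (h : IsUnit (f 0)) {k : ℕ} {g : Fn K}
    (hg : g ∈ lowerSpan f (k + 1)) :
    darboux (f 0) g ∈ lowerSpan (fun j => darboux (f 0) (f (j + 1))) k := by
  suffices hle : lowerSpan f (k + 1) ≤
      (lowerSpan (fun j => darboux (f 0) (f (j + 1))) k).comap (darboux (f 0)) from hle hg
  refine Submodule.span_le.mpr ?_
  rintro _ ⟨i, hi, rfl⟩
  rcases i with _ | i
  · change darboux (f 0) (f 0) ∈ lowerSpan (fun j => darboux (f 0) (f (j + 1))) k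
    rw [darboux_self h]
    exact Submodule.zero_mem _
  · exact mem_lowerSpan (fun j => darboux (f 0) (f (j + 1))) (Nat.lt_of_succ_lt_succ hi)

/-- Two antiderivatives of one function differ by an x-independent function, so two values of L(f)
differ by a combination of the Φ_j. The scalars are functions of the higher times, not just elements
of K. -/
theorem LaxActs.sub_mem {m : ℕ} {L : PsiDO K} {Φ Ψ : Fin m → Fn K} {f g g' : Fn K}
    (h : LaxActs L Φ Ψ f g) (h' : LaxActs L Φ Ψ f g') {V : Submodule (xconst K) (Fn K)}
    (hV : ∀ i, Φ i ∈ V) : g - g' ∈ V := by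
  obtain ⟨S, hS, rfl⟩ := h
  obtain ⟨S', hS', rfl⟩ := h'
  rw [add_sub_add_left_eq_sub, ← Finset.sum_sub_distrib]
  refine Submodule.sum_mem _ fun j _ => ?_
  have hc : S j - S' j ∈ xconst K := by
    change dx _ = 0
    rw [dx_sub, hS, hS', sub_self]
  rw [← mul_sub, mul_comm]
  exact V.smul_mem ⟨_, hc⟩ (hV j)

/-! ### Wronskians along Darboux–Bäcklund orbits -/

section Orbit

variable {m : ℕ} [NeZero m]

theorem gen_add_self (k : ℕ) : gen m (k + m) = gen m k := by
  simp [gen]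

theorem gen_add_ne {q k : ℕ} (h0 : 0 < k) (hk : k < m) : gen m (q + k) ≠ gen m q := by
  intro h
  have h1 : q + k ≡ q + 0 [MOD m] := congrArg Fin.val h
  have h2 := Nat.ModEq.add_left_cancel' q h1
  rw [Nat.ModEq, Nat.mod_eq_of_lt hk, Nat.zero_mod] at h2
  omega

theorem exists_gen_add_eq (q : ℕ) (i : Fin m) : ∃ k < m, gen m (q + k) = i := by
  refine ⟨(i + (m - q % m)) % m, Nat.mod_lt _ (NeZero.pos m), Fin.ext ?_⟩
  have h1 : q % m < m := Nat.mod_lt _ (NeZero.pos m)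
  have h2 : q + (i + (m - q % m)) = i + m * (q / m + 1) := by
    have := Nat.div_add_mod q m
    rw [mul_add, mul_one]
    omega
  simp only [gen]
  rw [Nat.add_mod_mod, h2, Nat.add_mul_mod_self_left, Nat.mod_eq_of_lt i.2]

/-- `f` lists the functions `Φ_{gen q}, Φ_{gen (q+1)}, …` followed by their iterated images under
`L`, up to combinations of the preceding members with coefficients that do not depend on `x`. -/
structure IsChain (q : ℕ) (L : PsiDO K) (Φ Ψ : Fin m → Fn K) (f : ℕ → Fn K) : Prop where
  init : ∀ k < m, f k - Φ (gen m (q + k)) ∈ lowerSpan f k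
  next : ∀ k, ∃ g, LaxActs L Φ Ψ (f k) g ∧ f (k + m) - g ∈ lowerSpan f (k + m)

theorem IsChain.apply_zero {q : ℕ} {L : PsiDO K} {Φ Ψ : Fin m → Fn K} {f : ℕ → Fn K}
    (h : IsChain q L Φ Ψ f) : f 0 = Φ (gen m q) := by
  have h0 := h.init 0 (NeZero.pos m)
  rwa [lowerSpan_zero, Submodule.mem_bot, sub_eq_zero] at h0

theorem IsChain.phi_mem {q : ℕ} {L : PsiDO K} {Φ Ψ : Fin m → Fn K} {f : ℕ → Fn K}
    (h : IsChain q L Φ Ψ f) (i : Fin m) : Φ i ∈ lowerSpan f m := by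
  obtain ⟨k, hk, rfl⟩ := exists_gen_add_eq q i
  rw [← sub_sub_cancel (f k) (Φ (gen m (q + k)))]
  exact Submodule.sub_mem _ (mem_lowerSpan f hk) (lowerSpan_mono f hk.le (h.init k hk))

theorem IsChain.step {q : ℕ} {L L' : PsiDO K} {Φ Ψ S Φ' Ψ' : Fin m → Fn K} {f : ℕ → Fn K}
    (h : IsChain q L Φ Ψ f) (hL : negPart L.1 = kernelOp Φ Ψ)
    (hs : IsDBStep (gen m q) L Φ Ψ S L' Φ' Ψ') :
    IsChain (q + 1) L' Φ' Ψ' fun k => darboux (f 0) (f (k + 1)) := by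
  have hu : IsUnit (f 0) := h.apply_zero ▸ hs.isUnit
  refine ⟨fun k hk => ?_, fun k => ?_⟩
  · rcases Nat.lt_or_ge (k + 1) m with hk' | hk'
    · have h1 := darboux_mem_lowerSpan hu (h.init (k + 1) hk')
      rwa [map_sub, h.apply_zero, darboux_apply _ (Φ _), ← hs.phi _ (gen_add_ne k.succ_pos hk'),
        ← h.apply_zero, Nat.succ_eq_one_add, ← add_assoc] at h1
    -- The index wraps around: the m-th new eigenfunction is T(L(Φ_a)), where L(Φ_a) uses the
    -- antiderivatives of the Darboux step. The chain may use others, which changes L(Φ_a) only by a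
    -- combination of the Φ_i.
    · obtain rfl : m = k + 1 := by omega
      obtain ⟨g, hg, hfg⟩ := h.next 0
      rw [h.apply_zero] at hg
      have h1 : LaxActs L Φ Ψ (Φ (gen (k + 1) q)) _ := ⟨S, hs.antideriv, rfl⟩
      have h2 := Submodule.add_mem _ (zero_add (k + 1) ▸ hfg) (hg.sub_mem h1 h.phi_mem)
      rw [sub_add_sub_cancel] at h2
      have h3 := darboux_mem_lowerSpan hu h2
      rw [map_sub, darboux_apply _ (act L _ + _), h.apply_zero, ← hs.phi_gen,
        ← h.apply_zero] at h3
      rwa [add_assoc q 1 k, add_comm 1 k, gen_add_self]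
  · obtain ⟨g, hg, hfg⟩ := h.next (k + 1)
    refine ⟨darboux (f 0) g, ?_, ?_⟩
    · rw [h.apply_zero]
      exact hs.laxActs hL hg
    · rw [add_right_comm] at hfg
      have h1 := darboux_mem_lowerSpan hu hfg
      rwa [map_sub] at h1

/-- The head of a chain is exactly the generating eigenfunction, as nothing precedes it. Crum's
reduction removes it and leaves the Wronskian of the chain for the next member of the orbit. -/
theorem wronskian_eq_prod_of_orbit (n : ℕ) {L : ℕ → PsiDO K} {Φ Ψ : ℕ → Fin m → Fn K} (q : ℕ)
    {f : ℕ → Fn K} (hL : negPart (L q).1 = kernelOp (Φ q) (Ψ q))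
    (hstep : ∀ k, k < n → ∃ S, IsDBStep (gen m (q + k)) (L (q + k)) (Φ (q + k)) (Ψ (q + k)) S
      (L (q + k + 1)) (Φ (q + k + 1)) (Ψ (q + k + 1)))
    (hf : IsChain q (L q) (Φ q) (Ψ q) f) :
    wronskian n f = ∏ k ∈ Finset.range n, Φ (q + k) (gen m (q + k)) := by
  induction n generalizing q f with
  | zero => simp [wronskian]
  | succ n ih =>
    obtain ⟨S, hS⟩ := hstep 0 n.succ_pos
    rw [add_zero] at hS
    have hu : IsUnit (f 0) := hf.apply_zero ▸ hS.isUnit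
    have e : ∀ k, q + (k + 1) = q + 1 + k := fun k => by ring
    have h1 := ih (q + 1) (hS.negPart_eq hL)
      (fun k hk => by
        have := hstep (k + 1) (Nat.succ_lt_succ hk)
        rwa [e] at this) (hf.step hL hS)
    rw [wronskian_succ n f hu, Finset.prod_range_succ', add_zero, mul_comm, hf.apply_zero,
      ← hf.apply_zero]
    rw [Finset.prod_congr rfl fun k _ => by rw [e k], ← h1]
    rfl

theorem isChain_iterates {L : PsiDO K} {Φ Ψ : Fin m → Fn K} {χ : ℕ → Fin m → Fn K}
    (hχ0 : χ 0 = Φ) (hχ : ∀ s i, LaxActs L Φ Ψ (χ s i) (χ (s + 1) i)) :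
    IsChain 0 L Φ Ψ fun k => χ (k / m) (gen m k) := by
  refine ⟨fun k hk => ?_, fun k => ⟨_, hχ (k / m) (gen m k), ?_⟩⟩
  · rw [Nat.div_eq_of_lt hk, hχ0, zero_add, sub_self]
    exact Submodule.zero_mem _
  · rw [Nat.add_div_right k (NeZero.pos m), gen_add_self, sub_self]
    exact Submodule.zero_mem _

theorem IsDBOrbit.tau_eq {n : ℕ} {L : ℕ → PsiDO K} {Φ Ψ : ℕ → Fin m → Fn K} {τ : ℕ → Fn K}
    (h : IsDBOrbit n L Φ Ψ τ) {k : ℕ} (hk : k ≤ n) :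
    τ k = (∏ j ∈ Finset.range k, Φ j (gen m j)) * τ 0 := by
  induction k with
  | zero => simp
  | succ k ih =>
    rw [h.tau k hk, ih (Nat.le_of_succ_le hk), Finset.prod_range_succ]
    ring

end Orbit

/-! ### Sums with coefficients proportional to the times -/

theorem coeff_time_mul_eq_zero {t0 : ℕ+ →₀ K} {k : ℕ+} {a : ℕ+ →₀ ℕ} (h : t0 k = 0)
    (ha : a k = 0) (g : Fn K) : MvPowerSeries.coeff a (time t0 k * g) = 0 := by
  classical
  rw [time, h, map_zero, zero_add, MvPowerSeries.coeff_mul]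
  refine Finset.sum_eq_zero fun p hp => ?_
  rw [MvPowerSeries.coeff_X, if_neg, zero_mul]
  rintro h
  have h2 := DFunLike.congr_fun (Finset.HasAntidiagonal.mem_antidiagonal.mp hp) k
  rw [h, ha] at h2
  simp at h2

/-- The members of a family `t_{r+l} g_l` that can contribute to the Taylor coefficient of
index `a`. -/
def contributors (t0 : ℕ+ →₀ K) (r : ℕ+) (a : ℕ+ →₀ ℕ) : Finset ℕ+ :=
  (t0.support ∪ a.support).preimage (r + ·) (add_right_injective r).injOn

theorem mem_contributors {t0 : ℕ+ →₀ K} {r : ℕ+} {a : ℕ+ →₀ ℕ} {l : ℕ+} :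
    l ∈ contributors t0 r a ↔ t0 (r + l) ≠ 0 ∨ a (r + l) ≠ 0 := by
  rw [contributors, Finset.mem_preimage, Finset.mem_union, Finsupp.mem_support_iff,
    Finsupp.mem_support_iff]

/-- The term `((l+r)/r) t_{r+l} g`. -/
def timeTerm (t0 : ℕ+ →₀ K) (r l : ℕ+) (g : Fn K) : Fn K :=
  time t0 (r + l) * (const (((l : ℕ) + (r : ℕ) : K) / ((r : ℕ) : K)) * g)

theorem timeTerm_add (t0 : ℕ+ →₀ K) (r l : ℕ+) (f g : Fn K) :
    timeTerm t0 r l (f + g) = timeTerm t0 r l f + timeTerm t0 r l g := by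
  simp only [timeTerm, mul_add]

theorem timeTerm_mul (t0 : ℕ+ →₀ K) (r l : ℕ+) (f g : Fn K) :
    timeTerm t0 r l (f * g) = f * timeTerm t0 r l g := by
  simp only [timeTerm]
  ring

theorem timeTerm_sum (t0 : ℕ+ →₀ K) (r l : ℕ+) {ι : Type*} (s : Finset ι) (g : ι → Fn K) :
    timeTerm t0 r l (∑ i ∈ s, g i) = ∑ i ∈ s, timeTerm t0 r l (g i) := by
  simp only [timeTerm, Finset.mul_sum]

theorem dx_const (c : K) : dx (const c) = 0 := MvPowerSeries.pderiv_C

theorem dx_time (t0 : ℕ+ →₀ K) (l : ℕ+) : dx (time t0 l) = if l = 1 then 1 else 0 := by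
  rw [time, dx_add, show dx (MvPowerSeries.C (t0 l)) = 0 from dx_const _, zero_add]
  change MvPowerSeries.pderiv K 1 _ = _
  classical
  rw [MvPowerSeries.pderiv_X, Pi.single_apply]

theorem pnat_add_ne_one (r l : ℕ+) : r + l ≠ 1 := by
  intro h
  have h1 := congrArg PNat.val h
  have h2 := r.pos
  have h3 := l.pos
  rw [PNat.add_coe, PNat.one_coe] at h1
  omega

theorem dx_timeTerm (t0 : ℕ+ →₀ K) (r l : ℕ+) (g : Fn K) :
    dx (timeTerm t0 r l g) = timeTerm t0 r l (dx g) := by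
  rw [timeTerm, dx_mul, dx_mul, dx_const, dx_time, if_neg (pnat_add_ne_one r l)]
  simp [timeTerm]

theorem coeff_formalSum_timeTerm (t0 : ℕ+ →₀ K) (r : ℕ+) (g : ℕ+ → Fn K) {a : ℕ+ →₀ ℕ}
    {S : Finset ℕ+} (hS : contributors t0 r a ⊆ S) :
    MvPowerSeries.coeff a (formalSum fun l => timeTerm t0 r l (g l)) =
      MvPowerSeries.coeff a (∑ l ∈ S, timeTerm t0 r l (g l)) := by
  rw [map_sum]
  refine finsum_eq_sum_of_support_subset _ fun l hl => hS ?_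
  rw [mem_contributors]
  by_contra! hc
  exact hl (coeff_time_mul_eq_zero hc.1 hc.2 _)

theorem contributors_mono (t0 : ℕ+ →₀ K) (r : ℕ+) {a b : ℕ+ →₀ ℕ} (h : a ≤ b) :
    contributors t0 r a ⊆ contributors t0 r b := by
  intro l hl
  rw [mem_contributors] at hl ⊢
  exact hl.imp_right fun h1 h2 => h1 (Nat.le_zero.mp (h2 ▸ h (r + l)))

/-- The formal sum `∑_{l ≥ 1} ((l+r)/r) t_{r+l} g_l`. -/
def timeSum (t0 : ℕ+ →₀ K) (r : ℕ+) : (ℕ+ → Fn K) →ₗ[Fn K] Fn K where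
  toFun g := formalSum fun l => timeTerm t0 r l (g l)
  map_add' f g := by
    ext a
    rw [map_add, coeff_formalSum_timeTerm t0 r f subset_rfl,
      coeff_formalSum_timeTerm t0 r g subset_rfl, coeff_formalSum_timeTerm t0 r _ subset_rfl,
      ← map_add, ← Finset.sum_add_distrib]
    simp only [Pi.add_apply, timeTerm_add]
  map_smul' h g := by
    classical
    ext a
    rw [coeff_formalSum_timeTerm t0 r _ subset_rfl, RingHom.id_apply, smul_eq_mul]
    simp only [Pi.smul_apply, smul_eq_mul, timeTerm_mul]
    rw [← Finset.mul_sum, MvPowerSeries.coeff_mul, MvPowerSeries.coeff_mul]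
    refine Finset.sum_congr rfl fun p hp => ?_
    rw [coeff_formalSum_timeTerm t0 r g (contributors_mono t0 r
      (Finset.HasAntidiagonal.mem_antidiagonal.mp hp ▸ le_add_self))]

theorem coeff_timeSum (t0 : ℕ+ →₀ K) (r : ℕ+) (g : ℕ+ → Fn K) {a : ℕ+ →₀ ℕ}
    {S : Finset ℕ+} (hS : contributors t0 r a ⊆ S) :
    MvPowerSeries.coeff a (timeSum t0 r g) =
      MvPowerSeries.coeff a (∑ l ∈ S, timeTerm t0 r l (g l)) :=
  coeff_formalSum_timeTerm t0 r g hS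

theorem timeSum_mul_right (t0 : ℕ+ →₀ K) (r : ℕ+) (g : ℕ+ → Fn K) (h : Fn K) :
    timeSum t0 r (fun l => g l * h) = timeSum t0 r g * h := by
  rw [mul_comm, ← smul_eq_mul, ← map_smul]
  congr 1
  funext l
  exact mul_comm _ _

theorem timeSum_mul_left (t0 : ℕ+ →₀ K) (r : ℕ+) (g : ℕ+ → Fn K) (h : Fn K) :
    timeSum t0 r (fun l => h * g l) = h * timeSum t0 r g :=
  map_smul (timeSum t0 r) h g

theorem timeSum_sum (t0 : ℕ+ →₀ K) (r : ℕ+) {ι : Type*} (s : Finset ι) (g : ι → ℕ+ → Fn K) :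
    timeSum t0 r (fun l => ∑ i ∈ s, g i l) = ∑ i ∈ s, timeSum t0 r (g i) := by
  rw [← map_sum]
  congr 1
  funext l
  rw [Finset.sum_apply]

/-- Since r + l ≥ 2, none of the coefficients t_{r+l} depends on x. -/
theorem timeSum_dx (t0 : ℕ+ →₀ K) (r : ℕ+) (g : ℕ+ → Fn K) :
    timeSum t0 r (fun l => dx (g l)) = dx (timeSum t0 r g) := by
  ext a
  have h : contributors t0 r (a + Finsupp.single 1 1) ⊆ contributors t0 r a := by
    intro l hl
    rw [mem_contributors] at hl ⊢
    rwa [Finsupp.add_apply, Finsupp.single_eq_of_ne, add_zero] at hl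
    exact pnat_add_ne_one r l
  change _ = MvPowerSeries.coeff a (MvPowerSeries.pderiv K 1 _)
  rw [MvPowerSeries.coeff_pderiv, coeff_timeSum t0 r g h, ← MvPowerSeries.coeff_pderiv,
    coeff_timeSum t0 r _ subset_rfl]
  congr 1
  refine Eq.trans ?_ (dx_sum _ _).symm
  exact Finset.sum_congr rfl fun l _ => (dx_timeTerm t0 r l _).symm

theorem timeSum_dx_iterate (t0 : ℕ+ →₀ K) (r : ℕ+) (k : ℕ) (g : ℕ+ → Fn K) :
    timeSum t0 r (fun l => dx^[k] (g l)) = dx^[k] (timeSum t0 r g) := by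
  induction k with
  | zero => rfl
  | succ k ih =>
    simp only [Function.iterate_succ_apply']
    rw [timeSum_dx, ih]

theorem dt_dx (l : ℕ+) (f : Fn K) : dt l (dx f) = dx (dt l f) := by
  ext a
  simp only [dx, dt, MvPowerSeries.coeff_pderiv]
  rw [add_right_comm]
  by_cases h : l = 1
  · subst h
    rfl
  · simp [h, Ne.symm h]
    ring

/-- The derivation `∑_{l ≥ 1} ((l+r)/r) t_{r+l} ∂/∂t_l`. -/
def euler (t0 : ℕ+ →₀ K) (r : ℕ+) : Derivation K (Fn K) (Fn K) :=
  Derivation.mk' (((timeSum t0 r).restrictScalars K).comp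
    (LinearMap.pi fun l => (MvPowerSeries.pderiv K l).toLinearMap)) fun f g => by
      change timeSum t0 r (fun l => MvPowerSeries.pderiv K l (f * g)) =
        f * timeSum t0 r (fun l => MvPowerSeries.pderiv K l g) +
          g * timeSum t0 r (fun l => MvPowerSeries.pderiv K l f)
      rw [← timeSum_mul_left, ← timeSum_mul_left, ← map_add]
      congr 1
      funext l
      exact Derivation.leibniz _ f g

theorem euler_apply (t0 : ℕ+ →₀ K) (r : ℕ+) (f : Fn K) :
    euler t0 r f = timeSum t0 r fun l => dt l f := rfl

theorem euler_dx (t0 : ℕ+ →₀ K) (r : ℕ+) (f : Fn K) :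
    euler t0 r (dx f) = dx (euler t0 r f) := by
  rw [euler_apply, euler_apply, ← timeSum_dx]
  simp only [dt_dx]

theorem stringOp_eq (t0 : ℕ+ →₀ K) (r : ℕ+) (n : ℕ) (f : Fn K) :
    stringOp t0 r n f = euler t0 r f + n * time t0 r * f := rfl

/-! ### Products with formal sums of operators of uniformly bounded order -/

section Families

variable {t0 : ℕ+ →₀ K} {r : ℕ+} {G : PsiDO K} {P : ℕ+ → PsiDO K} {N : ℤ}

theorem ordLE_of_coeff_eq_timeSum (hG : ∀ j, G.1 j = timeSum t0 r fun l => (P l).1 j)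
    (hP : ∀ l, OrdLE (P l) N) : OrdLE G N := fun j hj => by
  rw [hG]
  simp only [hP _ j hj]
  exact map_zero (timeSum t0 r)

/-- The common bound N on the orders gives one finite box for all l, over which the formal sum can
be exchanged with the product. -/
theorem coeff_mul_eq_timeSum (hG : ∀ j, G.1 j = timeSum t0 r fun l => (P l).1 j)
    (hP : ∀ l, OrdLE (P l) N) (Q : PsiDO K) (n : ℤ) :
    (G * Q).1 n = timeSum t0 r fun l => (P l * Q).1 n := by
  obtain ⟨M, hM⟩ := exists_ordLE Q
  have hB : M - n + N < ((M - n + N).toNat + 1 : ℕ) := by omega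
  simp only [coeff_mul_box (ordLE_of_coeff_eq_timeSum hG hP) hM le_rfl le_rfl hB,
    fun l => coeff_mul_box (hP l) hM le_rfl le_rfl hB, timeSum_sum, hG]
  refine Finset.sum_congr rfl fun i _ => Finset.sum_congr rfl fun k _ => ?_
  rw [← timeSum_mul_right, ← map_zsmul]
  rfl

theorem coeff_mul_eq_timeSum' (hG : ∀ j, G.1 j = timeSum t0 r fun l => (P l).1 j)
    (hP : ∀ l, OrdLE (P l) N) (Q : PsiDO K) (n : ℤ) :
    (Q * G).1 n = timeSum t0 r fun l => (Q * P l).1 n := by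
  obtain ⟨M, hM⟩ := exists_ordLE Q
  have hB : N - n + M < ((N - n + M).toNat + 1 : ℕ) := by omega
  simp only [coeff_mul_box hM (ordLE_of_coeff_eq_timeSum hG hP) le_rfl le_rfl hB,
    fun l => coeff_mul_box hM (hP l) le_rfl le_rfl hB, timeSum_sum, hG]
  refine Finset.sum_congr rfl fun i _ => Finset.sum_congr rfl fun k _ => ?_
  rw [← timeSum_dx_iterate, ← timeSum_mul_left, ← map_zsmul]
  rfl

end Families

/-! ### The string condition -/

theorem coeff_mul_top {P Q : PsiDO K} {N M : ℤ} (hP : OrdLE P N) (hQ : OrdLE Q M) :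
    (P * Q).1 (N + M) = P.1 N * Q.1 M := by
  have h := coeff_mul_box hP hQ (n := N + M) (A := N) (N' := N) (B := 1) (by omega) le_rfl
    (by omega)
  simpa using h

/-! ### Consequences of the Wilson–Sato equations -/

namespace IsDressing

variable {W Winv : PsiDO K}

theorem ordLE (h : IsDressing W Winv) : OrdLE W 0 := h.coeff_pos

/-- W has leading coefficient 1, so the leading coefficient of `Winv` is also that of the product W
W⁻¹ = 1 and cannot sit in positive degree. -/
theorem ordLE_inv (h : IsDressing W Winv) : OrdLE Winv 0 := by
  obtain ⟨N, hN⟩ := exists_ordLE_nat Winv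
  induction N with
  | zero => exact hN
  | succ N ih =>
    refine ih fun j hj => ?_
    rcases eq_or_ne j (N + 1 : ℕ) with rfl | hne
    · have h1 := coeff_mul_top h.ordLE hN
      rw [h.mul_inv, h.coeff_zero, one_mul, D, coeff_mono, if_neg (by omega)] at h1
      exact h1.symm
    · exact hN j (by omega)

theorem coeff_inv_zero (h : IsDressing W Winv) : Winv.1 0 = 1 := by
  have h1 := coeff_mul_top h.ordLE h.ordLE_inv
  rwa [h.mul_inv, h.coeff_zero, one_mul, add_zero, D, coeff_mono, if_pos rfl, eq_comm] at h1

theorem ordLE_laxPow (h : IsDressing W Winv) (l : ℕ+) : OrdLE (laxPow W Winv l) (l : ℕ) := by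
  have h1 := (h.ordLE.mul (ordLE_D ((l : ℕ) : ℤ))).mul h.ordLE_inv
  rwa [zero_add, add_zero] at h1

theorem mapD_dressing (h : IsDressing W Winv) (l : ℕ+) :
    mapD (MvPowerSeries.pderiv K l) W = -(negPart (laxPow W Winv l).1 * W) :=
  psido_ext fun j => h.sato l j

theorem mapD_inv (h : IsDressing W Winv) (l : ℕ+) :
    mapD (MvPowerSeries.pderiv K l) Winv = Winv * negPart (laxPow W Winv l).1 := by
  have h1 := mapD_mul (dt_dx l) W Winv
  rw [h.mul_inv, mapD_D, h.mapD_dressing, neg_mul, mul_assoc, h.mul_inv, D_zero, mul_one] at h1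
  have h2 := congrArg (Winv * ·) (eq_neg_add_iff_add_eq.mp h1)
  simp only [add_zero] at h2
  rw [h2, ← mul_assoc, h.inv_mul, D_zero, one_mul]

theorem mapD_laxPow (h : IsDressing W Winv) (r l : ℕ+) : mapD (MvPowerSeries.pderiv K l) (laxPow W Winv r) =
    laxPow W Winv r * negPart (laxPow W Winv l).1 -
      negPart (laxPow W Winv l).1 * laxPow W Winv r := by
  conv_lhs => rw [laxPow]
  rw [mapD_mul (dt_dx l), mapD_mul (dt_dx l), mapD_D, h.mapD_dressing, h.mapD_inv, mul_zero,
    add_zero]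
  simp only [laxPow, mul_assoc, neg_mul]
  abel

end IsDressing

theorem D_mul_fn_of_dx_const {f : Fn K} (hf : dx (dx f) = 0) (n : ℕ) :
    D n * fn f = fn f * D n + (n : PsiDO K) * (fn (dx f) * D (n - 1)) := by
  induction n with
  | zero => simp [D_zero]
  | succ n ih =>
    have e1 : (D ((n + 1 : ℕ) : ℤ) : PsiDO K) = D n * D 1 := by rw [D_mul_D]; rfl
    have e2 : (D (((n + 1 : ℕ) : ℤ) - 1) : PsiDO K) = D n := by congr 1; push_cast; ring
    have e3 : (D ((n : ℤ) - 1) * D 1 : PsiDO K) = D n := by rw [D_mul_D]; congr 1; ring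
    have e4 : D n * fn (dx f) = fn (dx f) * D n := by
      clear ih e1 e2 e3
      induction n with
      | zero => simp [D_zero]
      | succ n ih =>
        have e1 : (D ((n + 1 : ℕ) : ℤ) : PsiDO K) = D n * D 1 := by rw [D_mul_D]; rfl
        rw [e1, mul_assoc, D_one_mul_fn, hf, fn_zero, add_zero, ← mul_assoc, ih, mul_assoc]
    rw [e2, e1, mul_assoc, D_one_mul_fn, mul_add, e4, ← mul_assoc, ih, add_mul]
    simp only [mul_assoc, e3, Nat.cast_add, Nat.cast_one, add_mul, one_mul]
    abel

theorem natCast_mul_const_inv [CharZero K] (r : ℕ+) :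
    ((r : ℕ) : PsiDO K) * fn (const (((r : ℕ) : K)⁻¹)) = 1 := by
  rw [← nsmul_eq_mul]
  refine (map_nsmul fnHom _ _).symm.trans ?_
  change fn ((r : ℕ) • MvPowerSeries.C (((r : ℕ) : K)⁻¹)) = 1
  rw [← map_nsmul, nsmul_eq_mul, mul_inv_cancel₀ (Nat.cast_ne_zero.mpr r.ne_zero), map_one, fn_one]

theorem bareX_eq (t0 : ℕ+ →₀ K) (r : ℕ+) : bareX t0 r = ∑ l ∈ Finset.Icc 1 r,
    fn (const (((l : ℕ) : K) / ((r : ℕ) : K)) * time t0 l) * D ((l : ℕ) - (r : ℕ) : ℤ) :=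
  Finset.sum_congr rfl fun _ _ => (fn_mul_D _ _).symm

/-- Only the term l = 1, namely (x/r) D^{1-r}, has a coefficient depending on x; moving D^r past x/r
produces 1. -/
theorem bareX_commutator [CharZero K] (t0 : ℕ+ →₀ K) (r : ℕ+) :
    bareX t0 r * D (r : ℕ) - D (r : ℕ) * bareX t0 r = -1 := by
  have key : ∀ l : ℕ+, D (r : ℕ) * (fn (const (((l : ℕ) : K) / ((r : ℕ) : K)) * time t0 l) *
      D ((l : ℕ) - (r : ℕ) : ℤ)) = fn (const (((l : ℕ) : K) / ((r : ℕ) : K)) * time t0 l) *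
      D ((l : ℕ) - (r : ℕ) : ℤ) * D (r : ℕ) + if l = 1 then 1 else 0 := by
    intro l
    have hd : dx (const (((l : ℕ) : K) / ((r : ℕ) : K)) * time t0 l) =
        if l = 1 then const (((r : ℕ) : K)⁻¹) else 0 := by
      rw [dx_mul, dx_const, dx_time]
      split_ifs with hl
      · subst hl
        simp
      · simp
    rw [← mul_assoc, D_mul_fn_of_dx_const, hd, add_mul, mul_assoc, mul_assoc, mul_assoc, D_mul_D,
      D_mul_D, add_comm ((r : ℕ) : ℤ), mul_assoc (fn _), D_mul_D]
    · congr 1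
      split_ifs with hl
      · subst hl
        rw [← mul_assoc, natCast_mul_const_inv, one_mul, PNat.one_coe, ← D_zero]
        congr 1
        push_cast
        ring
      · simp [fn_zero]
    · rw [hd]
      split_ifs
      · exact dx_const _
      · exact dx_zero
  rw [bareX_eq, Finset.mul_sum, Finset.sum_congr rfl fun l _ => key l, Finset.sum_add_distrib,
    Finset.sum_ite_eq', if_pos (Finset.mem_Icc.mpr ⟨le_rfl, one_le⟩), Finset.sum_mul]
  abel

theorem ordLE_bareX (t0 : ℕ+ →₀ K) (r : ℕ+) : OrdLE (bareX t0 r) 0 := by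
  refine OrdLE.sum fun l hl j hj => ?_
  have h : (l : ℕ) ≤ r := (Finset.mem_Icc.mp hl).2
  rw [coeff_mono, if_neg (by omega)]

theorem coeff_bareX_zero [CharZero K] (t0 : ℕ+ →₀ K) (r : ℕ+) :
    (bareX t0 r).1 0 = time t0 r := by
  rw [bareX, coeff_sum, Finset.sum_eq_single r]
  · rw [coeff_mono, if_pos (by omega), div_self (Nat.cast_ne_zero.mpr r.ne_zero), const, map_one,
      one_mul]
  · intro l _ hl
    have h : (l : ℕ) ≠ r := fun h => hl (PNat.coe_injective h)
    rw [coeff_mono, if_neg (by omega)]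
  · intro h
    exact absurd (Finset.mem_Icc.mpr ⟨one_le, le_rfl⟩) h

section String

variable {t0 : ℕ+ →₀ K} {r : ℕ+} {W Winv : PsiDO K}

theorem IsDressing.ordLE_bare (h : IsDressing W Winv) : OrdLE (W * bareX t0 r * Winv) 0 :=
  (h.ordLE.mul (ordLE_bareX t0 r)).mul h.ordLE_inv

theorem IsDressing.coeff_bare_zero [CharZero K] (h : IsDressing W Winv) : (W * bareX t0 r * Winv).1 0 = time t0 r := by
  have h1 := coeff_mul_top (h.ordLE.mul (ordLE_bareX t0 r)) h.ordLE_inv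
  have h2 := coeff_mul_top h.ordLE (ordLE_bareX t0 r)
  rwa [h2, h.coeff_zero, one_mul, h.coeff_inv_zero, mul_one, coeff_bareX_zero] at h1

theorem IsDressing.bare_commutator [CharZero K] (h : IsDressing W Winv) :
    W * bareX t0 r * Winv * laxPow W Winv r -
    laxPow W Winv r * (W * bareX t0 r * Winv) = -1 := by
  have e : ∀ A B : PsiDO K, W * A * Winv * (W * B * Winv) = W * (A * B) * Winv := fun A B => by
    calc W * A * Winv * (W * B * Winv) = W * A * (Winv * W) * B * Winv := by
          simp only [mul_assoc]
      _ = W * (A * B) * Winv := by rw [h.inv_mul, D_zero, mul_one]; simp only [mul_assoc]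
  rw [laxPow, e, e, ← sub_mul, ← mul_sub, bareX_commutator, mul_neg, mul_one, neg_mul, h.mul_inv,
    D_zero]

theorem IsDressing.negPart_bare [CharZero K] (h : IsDressing W Winv) :
    negPart (W * bareX t0 r * Winv).1 = W * bareX t0 r * Winv - fn (time t0 r) :=
  psido_ext fun j => by
    rw [coeff_negPart, coeff_sub, coeff_fn]
    rcases lt_trichotomy j 0 with hj | rfl | hj
    · rw [if_pos hj, if_neg hj.ne, sub_zero]
    · rw [if_neg (lt_irrefl _), if_pos rfl, h.coeff_bare_zero, sub_self]
    · rw [if_neg hj.not_gt, if_neg hj.ne', h.ordLE_bare j hj, sub_zero]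

/-- The string condition on the Lax operator: `[∑ ((l+r)/r) t_{r+l} ∂/∂t_l + t_r, L] = -1`. -/
theorem IsDressing.string_lax [CharZero K] (h : IsDressing W Winv)
    (hL : flowL t0 r W Winv = 0) :
    mapD (euler t0 r) (laxPow W Winv r) + fn (time t0 r) * laxPow W Winv r -
      laxPow W Winv r * fn (time t0 r) = -1 := by
  set L := laxPow W Winv r with hLdef
  set P : ℕ+ → PsiDO K := fun l => negPart (laxPow W Winv l).1 with hP
  -- M itself has infinite order, but its negative part does not: the operators (L^{l/r})_- all have
  -- order at most -1, so they sum to a genuine operator.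
  set G : PsiDO K := negPart fun j => timeSum t0 r fun l => (laxPow W Winv l).1 j with hG
  have hGP : ∀ j, G.1 j = timeSum t0 r fun l => (P l).1 j := by
    intro j
    simp only [hG, hP, coeff_negPart]
    split_ifs
    · rfl
    · exact (map_zero (timeSum t0 r)).symm
  have hM : negPart (opM t0 r W Winv) = W * bareX t0 r * Winv - fn (time t0 r) + G := by
    rw [← h.negPart_bare]
    refine psido_ext fun j => ?_
    simp only [hG, coeff_add, coeff_negPart]
    split_ifs
    · rfl
    · rw [add_zero]
  have hE : mapD (euler t0 r) L = L * G - G * L := by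
    refine psido_ext fun n => ?_
    rw [coeff_mapD, euler_apply, coeff_sub,
      coeff_mul_eq_timeSum hGP (fun l => ordLE_negPart _) L n,
      coeff_mul_eq_timeSum' hGP (fun l => ordLE_negPart _) L n, ← map_sub]
    congr 1
    funext l
    exact congrArg (fun A : PsiDO K => A.1 n) (h.mapD_laxPow r l)
  rw [flowL, neg_eq_zero, hM, ← hLdef] at hL
  have hb := h.bare_commutator (t0 := t0) (r := r)
  rw [← hLdef] at hb
  rw [hE, ← hb]
  simp only [add_mul, mul_add, sub_mul, mul_sub] at hL ⊢
  rw [← sub_eq_zero] at hL ⊢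
  rw [← neg_eq_zero, ← hL]
  abel

/-- M_+ is t_r plus the formal sum of ((l+r)/r) t_{r+l} (L^{l/r})_+, and each (L^{l/r})_+ acts on Φ
as ∂/∂t_l. -/
theorem IsDressing.flowPhi_eq [CharZero K] (h : IsDressing W Winv) {Φ : Fn K}
    (hΦ : ∀ l, dt l Φ = act (laxPow W Winv l) Φ) :
    flowPhi t0 r W Winv Φ = euler t0 r Φ + time t0 r * Φ := by
  ext a
  set S := contributors t0 r a
  -- For a fixed Taylor coefficient only the flows in S contribute, and B bounds their orders; this
  -- makes both sums finite and interchangeable.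
  set B := S.sup fun l => (l : ℕ) with hB
  have hle : ∀ l ∈ S, OrdLE (laxPow W Winv l) B := fun l hl =>
    (h.ordLE_laxPow l).mono (Int.ofNat_le.mpr (Finset.le_sup (f := fun l : ℕ+ => (l : ℕ)) hl))
  have hcoeff : ∀ j : ℕ, MvPowerSeries.coeff a (opM t0 r W Winv j * dx^[j] Φ) =
      MvPowerSeries.coeff a ((if j = 0 then time t0 r * Φ else 0) +
        ∑ l ∈ S, timeTerm t0 r l ((laxPow W Winv l).1 j * dx^[j] Φ)) := by
    intro j
    have h1 : opM t0 r W Winv j * dx^[j] Φ = (if j = 0 then time t0 r * Φ else 0) +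
        timeSum t0 r fun l => (laxPow W Winv l).1 j * dx^[j] Φ := by
      rw [timeSum_mul_right]
      change ((W * bareX t0 r * Winv).1 j + _) * _ = _
      rw [add_mul]
      congr 1
      split_ifs with hj
      · subst hj
        rw [Nat.cast_zero, h.coeff_bare_zero]
        rfl
      · rw [h.ordLE_bare j (by omega), zero_mul]
    rw [h1, map_add, map_add, coeff_timeSum t0 r _ subset_rfl]
  change ∑ᶠ j : ℕ, MvPowerSeries.coeff a (opM t0 r W Winv j * dx^[j] Φ) = _
  rw [finsum_congr hcoeff, finsum_eq_sum_of_support_subset (s := Finset.range (B + 1)), ← map_sum,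
    Finset.sum_add_distrib, Finset.sum_ite_eq', if_pos (by simp), Finset.sum_comm, euler_apply,
    map_add, map_add, coeff_timeSum t0 r _ subset_rfl, add_comm]
  · congr 2
    refine Finset.sum_congr rfl fun l hl => ?_
    rw [hΦ, act_eq_sum (hle l hl), timeTerm_sum]
  · intro j hj
    by_contra hc
    simp only [Finset.coe_range, Set.mem_Iio] at hc
    apply hj
    simp only
    rw [if_neg (by omega), Finset.sum_eq_zero, add_zero, map_zero]
    intro l hl
    rw [hle l hl j (by omega), zero_mul, timeTerm]
    simp

end String

/-! ### Antiderivatives vanishing at `x = 0` -/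

/-- The function `f` vanishes at `X₁ = 0`. -/
def VanishesAtZero (f : Fn K) : Prop := ∀ a : ℕ+ →₀ ℕ, a 1 = 0 → MvPowerSeries.coeff a f = 0

theorem VanishesAtZero.mul_left {f : Fn K} (h : VanishesAtZero f) (g : Fn K) :
    VanishesAtZero (g * f) := by
  classical
  intro a ha
  rw [MvPowerSeries.coeff_mul]
  refine Finset.sum_eq_zero fun p hp => ?_
  have h1 : p.1 + p.2 = a := Finset.HasAntidiagonal.mem_antidiagonal.mp hp
  have h2 : p.2 1 = 0 := by
    rw [← h1, Finsupp.add_apply] at ha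
    omega
  rw [h p.2 h2, mul_zero]

theorem VanishesAtZero.sum {ι : Type*} {s : Finset ι} {f : ι → Fn K}
    (h : ∀ i ∈ s, VanishesAtZero (f i)) : VanishesAtZero (∑ i ∈ s, f i) := by
  intro a ha
  rw [map_sum]
  exact Finset.sum_eq_zero fun i hi => h i hi a ha

theorem sub_single_add_single {a : ℕ+ →₀ ℕ} (h : a 1 ≠ 0) :
    a - Finsupp.single 1 1 + Finsupp.single 1 1 = a :=
  tsub_add_cancel_of_le (Finsupp.single_le_iff.mpr (Nat.one_le_iff_ne_zero.mpr h))

theorem eq_zero_of_vanishesAtZero [CharZero K] {f : Fn K} (h : ∀ k, VanishesAtZero (dx^[k] f)) :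
    f = 0 := by
  have key : ∀ (k : ℕ) (f : Fn K), (∀ k, VanishesAtZero (dx^[k] f)) →
      ∀ a : ℕ+ →₀ ℕ, a 1 = k → MvPowerSeries.coeff a f = 0 := by
    intro k
    induction k with
    | zero => exact fun f hf a ha => hf 0 a ha
    | succ k ih =>
      intro f hf a ha
      have h1 := sub_single_add_single (a := a) (by omega)
      have h2 := ih (dx f) (fun k => hf (k + 1)) (a - Finsupp.single 1 1) (by simp [ha])
      change MvPowerSeries.coeff _ (MvPowerSeries.pderiv K 1 f) = 0 at h2
      rw [MvPowerSeries.coeff_pderiv, h1] at h2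
      exact (mul_eq_zero.mp h2).resolve_right (Nat.cast_add_one_ne_zero _)
  ext a
  exact key (a 1) f h a rfl

theorem exists_antiderivative [CharZero K] (f : Fn K) : ∃ g, dx g = f ∧ VanishesAtZero g := by
  let g : Fn K := fun a => if a 1 = 0 then 0 else
    MvPowerSeries.coeff (a - Finsupp.single 1 1) f * ((a 1 : ℕ) : K)⁻¹
  have hg : ∀ a, MvPowerSeries.coeff a g = if a 1 = 0 then 0 else
    MvPowerSeries.coeff (a - Finsupp.single 1 1) f * ((a 1 : ℕ) : K)⁻¹ := fun _ => rfl
  refine ⟨g, ?_, fun a ha => by rw [hg, if_pos ha]⟩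
  ext a
  change MvPowerSeries.coeff _ (MvPowerSeries.pderiv K 1 g) = _
  have h0 : (a + Finsupp.single 1 1 : ℕ+ →₀ ℕ) 1 = a 1 + 1 := by simp
  rw [MvPowerSeries.coeff_pderiv, hg, h0, if_neg (Nat.succ_ne_zero _), add_tsub_cancel_right,
    mul_assoc, Nat.cast_succ, inv_mul_cancel₀ (Nat.cast_add_one_ne_zero _), mul_one]

/-! ### Kernel operators -/

section Kernel

variable {m : ℕ} {Φ Ψ : Fin m → Fn K}

theorem coeff_kernelOp_neg_one (Φ Ψ : Fin m → Fn K) :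
    (kernelOp Φ Ψ).1 (-1) = ∑ i, Φ i * Ψ i := by
  rw [kernelOp, coeff_sum]
  refine Finset.sum_congr rfl fun i _ => ?_
  have h := coeff_mul_top ((ordLE_fn (Φ i)).mul (ordLE_D (K := K) (-1))) (ordLE_fn (Ψ i))
  rw [zero_add, add_zero] at h
  rw [h, coeff_fn_mul]
  simp [D, coeff_mono, coeff_fn]

/-- Left multiplication by D differentiates the Φ_i, up to the zeroth-order term ∑ Φ_i Ψ_i, which is
the vanishing D⁻¹-coefficient. Iteration gives ∑ Φ_i^{(k)} Ψ_i = 0 for all k. -/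
theorem kernelOp_dx (h : kernelOp Φ Ψ = 0) : kernelOp (fun i => dx (Φ i)) Ψ = 0 := by
  have h0 : ∑ i, Φ i * Ψ i = 0 := by rw [← coeff_kernelOp_neg_one, h, coeff_zero]
  have h1 : D 1 * kernelOp Φ Ψ = kernelOp (fun i => dx (Φ i)) Ψ + fn (∑ i, Φ i * Ψ i) := by
    rw [kernelOp, kernelOp, Finset.mul_sum, fn_sum, ← Finset.sum_add_distrib]
    refine Finset.sum_congr rfl fun i _ => ?_
    rw [← mul_assoc, ← mul_assoc, D_one_fn_D_neg_one, add_mul, fn_mul_fn, add_comm]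
  rw [h, mul_zero, h0, fn_zero, add_zero] at h1
  exact h1.symm

theorem kernelOp_dx_iterate (h : kernelOp Φ Ψ = 0) (k : ℕ) :
    kernelOp (fun i => dx^[k] (Φ i)) Ψ = 0 := by
  induction k with
  | zero => exact h
  | succ k ih =>
    simp only [Function.iterate_succ_apply']
    exact kernelOp_dx ih

/-- By the relations ∑ Φ_i^{(k)} Ψ_i = 0, every x-derivative of the sum is ∑ Φ_i^{(k)} R_i, which
vanishes at X_1 = 0. In characteristic zero the Taylor expansion in x is then zero. -/
theorem sum_mul_antiderivative_eq_zero [CharZero K] (h : kernelOp Φ Ψ = 0) {f : Fn K}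
    {R : Fin m → Fn K} (hR : ∀ i, dx (R i) = Ψ i * f) (hR0 : ∀ i, VanishesAtZero (R i)) :
    ∑ i, Φ i * R i = 0 := by
  have hk : ∀ k, dx^[k] (∑ i, Φ i * R i) = ∑ i, dx^[k] (Φ i) * R i := by
    intro k
    induction k with
    | zero => rfl
    | succ k ih =>
      have h0 : ∑ i, dx^[k] (Φ i) * Ψ i = 0 := by
        rw [← coeff_kernelOp_neg_one (fun i => dx^[k] (Φ i)), kernelOp_dx_iterate h, coeff_zero]
      rw [Function.iterate_succ_apply', ih, dx_sum]
      simp only [dx_mul, hR, ← mul_assoc, Finset.sum_add_distrib, ← Finset.sum_mul, h0, zero_mul,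
        add_zero, Function.iterate_succ_apply']
  refine eq_zero_of_vanishesAtZero fun k => ?_
  rw [hk]
  exact VanishesAtZero.sum fun i _ => (hR0 i).mul_left _

/-- Inserting L = L_+ + ∑ Φ_i D⁻¹ Ψ_i into the string equation and using δΦ_i = -tΦ_i, the kernel
operator equals a differential operator. Having order at most -1, it vanishes. -/
theorem string_kernel {δ : Derivation K (Fn K) (Fn K)} (hδ : ∀ f, δ (dx f) = dx (δ f)) {t : Fn K}
    {L : PsiDO K} (hs : mapD δ L + fn t * L - L * fn t = -1) (hL : negPart L.1 = kernelOp Φ Ψ)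
    (hΦ : ∀ i, δ (Φ i) + t * Φ i = 0) : kernelOp Φ (fun i => δ (Ψ i) - t * Ψ i) = 0 := by
  set A := L - negPart L.1 with hA
  have hAd : IsDiff A := isDiff_sub_negPart L
  have hmA : IsDiff (mapD δ A) := fun j hj => by rw [coeff_mapD, hAd j hj, map_zero]
  have hLA : L = A + kernelOp Φ Ψ := by rw [hA, hL, sub_add_cancel]
  have h1 : mapD δ (kernelOp Φ Ψ) + fn t * kernelOp Φ Ψ - kernelOp Φ Ψ * fn t =
      kernelOp Φ fun i => δ (Ψ i) - t * Ψ i := by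
    simp only [kernelOp]
    rw [map_sum, Finset.mul_sum, Finset.sum_mul, ← Finset.sum_add_distrib,
      ← Finset.sum_sub_distrib]
    refine Finset.sum_congr rfl fun i _ => ?_
    have h2 : fn (δ (Φ i)) = -(fn t * fn (Φ i)) := by
      rw [fn_mul_fn, ← fn_neg, eq_neg_of_add_eq_zero_left (hΦ i)]
    rw [mapD_mul hδ, mapD_mul hδ, mapD_D, mapD_fn, mapD_fn, mul_zero, add_zero, h2, fn_sub,
      mul_comm t, ← fn_mul_fn, mul_sub]
    simp only [neg_mul, mul_assoc]
    abel
  have h2 : kernelOp Φ (fun i => δ (Ψ i) - t * Ψ i) =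
      fn (-1) - (mapD δ A + fn t * A - A * fn t) := by
    rw [← h1, fn_neg, fn_one, ← hs, hLA, map_add]
    simp only [mul_add, add_mul]
    abel
  have h3 : IsDiff (kernelOp Φ fun i => δ (Ψ i) - t * Ψ i) := by
    rw [h2]
    exact (isDiff_fn _).sub ((hmA.add ((isDiff_fn t).mul hAd)).sub (hAd.mul (isDiff_fn t)))
  rw [← negPart_eq_self (ordLE_kernelOp Φ _), negPart_eq_zero h3]

/-- The string condition exchanges `L` and `∑ ((l+r)/r) t_{r+l} ∂/∂t_l + t_r` up to lower terms. -/
theorem LaxActs.string [CharZero K] {δ : Derivation K (Fn K) (Fn K)}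
    (hδ : ∀ f, δ (dx f) = dx (δ f)) {t : Fn K}
    {L : PsiDO K} (hs : mapD δ L + fn t * L - L * fn t = -1) (hL : negPart L.1 = kernelOp Φ Ψ)
    (hΦ : ∀ i, δ (Φ i) + t * Φ i = 0) {f g : Fn K} (h : LaxActs L Φ Ψ f g) :
    LaxActs L Φ Ψ (δ f + t * f) (δ g + t * g + f) := by
  obtain ⟨S, hS, rfl⟩ := h
  -- The normalization at X_1 = 0 forces ∑ Φ_i R_i = 0; other antiderivatives would add a
  -- combination of the Φ_i. Subtracting R_j from δS_j corrects its derivative to Ψ_j(δf + tf).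
  choose R hR hR0 using fun i => exists_antiderivative ((δ (Ψ i) - t * Ψ i) * f)
  have hact : δ (act L f) + t * act L f + f = act L (δ f + t * f) := by
    have h1 : δ (act L f) = act (mapD δ L) f + act L (δ f) := by
      rw [act_eq_coeff, ← coeff_mapD, mapD_mul hδ, mapD_fn, coeff_add, ← act_eq_coeff,
        ← act_eq_coeff]
    have h2 : act (mapD δ L + fn t * L - L * fn t) f = -f := by
      rw [hs, ← fn_one, ← fn_neg, act_fn, neg_one_mul]
    rw [act_sub, act_add, act_eq_coeff (fn t * L), mul_assoc, coeff_fn_mul, ← act_eq_coeff,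
      act_eq_coeff (L * fn t), mul_assoc, fn_mul_fn, ← act_eq_coeff] at h2
    rw [h1, act_add_right]
    linear_combination h2
  refine ⟨fun j => δ (S j) - R j, fun j => ?_, ?_⟩
  · rw [dx_sub, ← hδ, hS, hR, Derivation.leibniz, smul_eq_mul, smul_eq_mul]
    ring
  · have hR' := sum_mul_antiderivative_eq_zero (string_kernel hδ hs hL hΦ) hR hR0
    have h3 : δ (∑ j, Φ j * S j) + t * ∑ j, Φ j * S j = ∑ j, Φ j * δ (S j) := by
      rw [map_sum, Finset.mul_sum, ← Finset.sum_add_distrib]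
      refine Finset.sum_congr rfl fun j _ => ?_
      rw [Derivation.leibniz, smul_eq_mul, smul_eq_mul]
      linear_combination S j * hΦ j
    simp only [mul_sub, Finset.sum_sub_distrib]
    rw [hR', sub_zero, ← h3, ← hact, map_add]
    ring

end Kernel

/-! ### The string operator on Wronskians -/

section Span

variable {m : ℕ} {L : PsiDO K} {Φ Ψ : Fin m → Fn K} {f : ℕ → Fn K}

theorem exists_laxActs_of_mem_lowerSpan (hf : ∀ k, LaxActs L Φ Ψ (f k) (f (k + m))) {k : ℕ}
    {h : Fn K} (hh : h ∈ lowerSpan f k) : ∃ g ∈ lowerSpan f (k + m), LaxActs L Φ Ψ h g := by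
  induction hh using Submodule.span_induction with
  | mem x hx =>
    obtain ⟨i, hi, rfl⟩ := hx
    exact ⟨f (i + m), mem_lowerSpan f (Nat.add_lt_add_right hi m), hf i⟩
  | zero =>
    refine ⟨0, Submodule.zero_mem _, 0, fun j => by rw [Pi.zero_apply, dx_zero, mul_zero], ?_⟩
    simp [act, dx_iterate_zero]
  | add x y _ _ hx hy =>
    obtain ⟨g, hg, S, hS, rfl⟩ := hx
    obtain ⟨g', hg', S', hS', rfl⟩ := hy
    refine ⟨_, Submodule.add_mem _ hg hg', S + S', fun j => ?_, ?_⟩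
    · rw [Pi.add_apply, dx_add, hS, hS', mul_add]
    · simp only [Pi.add_apply, mul_add, Finset.sum_add_distrib, act_add_right]
      ring
  | smul c x _ hx =>
    obtain ⟨g, hg, S, hS, rfl⟩ := hx
    refine ⟨_, Submodule.smul_mem _ c hg, fun j => c.1 * S j, fun j => ?_, ?_⟩
    · rw [dx_xconst_mul, hS]
      exact mul_left_comm _ _ _
    · have hc : act L (c.1 * x) = c.1 * act L x := by
        rw [act, act, mul_finsum]
        refine finsum_congr fun j => ?_
        have : dx^[j] (c.1 * x) = c.1 * dx^[j] x := by
          induction j with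
          | zero => rfl
          | succ j ih =>
            rw [Function.iterate_succ_apply', ih, dx_xconst_mul, Function.iterate_succ_apply']
        rw [this, mul_left_comm]
      change c.1 * _ = act L (c.1 * x) + _
      rw [hc, mul_add, Finset.mul_sum]
      simp only [mul_left_comm]

/-- By `LaxActs.string`, (δ + t)f_{j+m} is L((δ + t)f_j) - f_j modulo the Φ_i. L raises indices by
m, so a combination of terms below f_j becomes one of terms below f_{j+m}. -/
theorem string_mem_lowerSpan [NeZero m] [CharZero K] {δ : Derivation K (Fn K) (Fn K)}
    (hδ : ∀ f, δ (dx f) = dx (δ f)) {t : Fn K}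
    (hs : mapD δ L + fn t * L - L * fn t = -1) (hL : negPart L.1 = kernelOp Φ Ψ)
    (hΦ : ∀ i, δ (Φ i) + t * Φ i = 0) (hf0 : ∀ k < m, f k = Φ (gen m k))
    (hf : ∀ k, LaxActs L Φ Ψ (f k) (f (k + m))) (k : ℕ) :
    δ (f k) + t * f k ∈ lowerSpan f k := by
  induction k using Nat.strong_induction_on with
  | _ k ih =>
    rcases Nat.lt_or_ge k m with hk | hk
    · rw [hf0 k hk, hΦ]
      exact Submodule.zero_mem _
    · obtain ⟨j, rfl⟩ := Nat.exists_eq_add_of_le' hk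
      have hm : 0 < m := NeZero.pos m
      obtain ⟨g, hg, hgL⟩ := exists_laxActs_of_mem_lowerSpan hf (ih j (by omega))
      have hΦm : ∀ i, Φ i ∈ lowerSpan f (j + m) := fun i => by
        obtain ⟨k, hk, rfl⟩ := exists_gen_add_eq 0 i
        rw [zero_add, ← hf0 k hk]
        exact mem_lowerSpan f (by omega)
      have h1 := ((hf j).string hδ hs hL hΦ).sub_mem hgL hΦm
      have h2 := Submodule.sub_mem _ (Submodule.add_mem _ h1 hg)
        (mem_lowerSpan f (show j < j + m by omega))
      rwa [sub_add_cancel, add_sub_cancel_right] at h2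

end Span

/-! ### Derivations of determinants -/

theorem derivation_prod (δ : Derivation K (Fn K) (Fn K)) {ι : Type*} [DecidableEq ι]
    (s : Finset ι) (g : ι → Fn K) :
    δ (∏ i ∈ s, g i) = ∑ k ∈ s, ∏ i ∈ s, if i = k then δ (g i) else g i := by
  induction s using Finset.induction_on with
  | empty => simp
  | insert a s ha ih =>
    rw [Finset.prod_insert ha, Derivation.leibniz, ih, Finset.sum_insert ha,
      Finset.prod_insert ha, if_pos rfl, smul_eq_mul, smul_eq_mul, Finset.mul_sum, add_comm]
    congr 1
    · rw [mul_comm]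
      congr 1
      refine Finset.prod_congr rfl fun i hi => (if_neg ?_).symm
      rintro rfl
      exact ha hi
    · refine Finset.sum_congr rfl fun k hk => ?_
      rw [Finset.prod_insert ha, if_neg]
      rintro rfl
      exact ha hk

/-- Jacobi's formula. -/
theorem derivation_det (δ : Derivation K (Fn K) (Fn K)) {n : ℕ}
    (M : Matrix (Fin n) (Fin n) (Fn K)) :
    δ M.det = (M.adjugate * M.map δ).trace := by
  have h1 : ∀ k, (M.adjugate * M.map δ) k k = (M.updateCol k fun i => δ (M i k)).det := by
    intro k
    rw [← Matrix.cramer_apply, Matrix.cramer_eq_adjugate_mulVec]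
    rfl
  rw [Matrix.trace]
  simp only [Matrix.diag_apply, h1, Matrix.det_apply]
  rw [map_sum, Finset.sum_comm]
  refine Finset.sum_congr rfl fun σ _ => ?_
  rw [Units.smul_def, map_zsmul, derivation_prod, Finset.smul_sum]
  refine Finset.sum_congr rfl fun k _ => ?_
  rw [Units.smul_def]
  congr 1
  refine Finset.prod_congr rfl fun i _ => ?_
  rw [Matrix.updateCol_apply]
  split_ifs with h
  · rw [h]
  · rfl

theorem dx_iterate_mul_of_dx_const {t : Fn K} (ht : dx (dx t) = 0) (i : ℕ) (f : Fn K) :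
    dx^[i] (t * f) = t * dx^[i] f + i * dx t * dx^[i - 1] f := by
  induction i with
  | zero => simp
  | succ i ih =>
    rw [Function.iterate_succ_apply', ih, dx_add, dx_mul, mul_assoc, ← nsmul_eq_mul]
    change _ + MvPowerSeries.pderiv K 1 _ = _
    rw [map_nsmul]
    change _ + i • dx _ = _
    rw [dx_mul, ht, zero_mul, zero_add, Nat.add_sub_cancel, Function.iterate_succ_apply']
    rcases i with _ | i
    · simp
      ring
    · rw [Nat.add_sub_cancel, ← Function.iterate_succ_apply' dx i, nsmul_eq_mul]
      push_cast
      ring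

theorem exists_coeff_of_mem_lowerSpan {f : ℕ → Fn K} {k : ℕ} {h : Fn K}
    (hh : h ∈ lowerSpan f k) : ∃ c : ℕ → xconst K, (∀ i, k ≤ i → c i = 0) ∧
      h = ∑ i ∈ Finset.range k, (c i).1 * f i := by
  classical
  rw [lowerSpan, ← Finset.coe_range, Submodule.mem_span_image_finset_iff_exists_fun'] at hh
  obtain ⟨c, rfl⟩ := hh
  refine ⟨fun i => if i < k then c i else 0, fun i hi => if_neg (by omega), ?_⟩
  refine Finset.sum_congr rfl fun i hi => ?_
  simp only [if_pos (Finset.mem_range.mp hi)]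
  rfl

/-- The Wronskian matrix satisfies δM = M U - N M. In Jacobi's formula the adjugate turns this into
det M (tr U - tr N), so M need not be invertible. -/
theorem string_wronskian {δ : Derivation K (Fn K) (Fn K)} (hδ : ∀ f, δ (dx f) = dx (δ f))
    {t : Fn K} (ht : dx (dx t) = 0) {f : ℕ → Fn K}
    (hf : ∀ k, δ (f k) + t * f k ∈ lowerSpan f k) (n : ℕ) :
    δ (wronskian n f) + n * t * wronskian n f = 0 := by
  choose c hc0 hc using fun k => exists_coeff_of_mem_lowerSpan (hf k)
  set M : Matrix (Fin n) (Fin n) (Fn K) := Matrix.of fun i j => dx^[(i : ℕ)] (f j) with hM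
  -- N encodes the Leibniz rule for t f. Its subdiagonal matters only for r = 1, when t = x; its
  -- trace is n t in every case. U is strictly upper triangular, as each f_k yields only earlier
  -- functions.
  set N : Matrix (Fin n) (Fin n) (Fn K) := Matrix.of fun i j =>
    (if (j : ℕ) = i then t else 0) + if (j : ℕ) + 1 = i then (i : ℕ) * dx t else 0 with hN
  set U : Matrix (Fin n) (Fin n) (Fn K) := Matrix.of fun i j => (c j i).1 with hU
  have hiter : ∀ (k : ℕ) (c : xconst K) (g : Fn K), dx^[k] (c.1 * g) = c.1 * dx^[k] g := by
    intro k c g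
    rw [dx_iterate_mul_of_dx_const (by rw [show dx c.1 = 0 from c.2, dx_zero]),
      show dx c.1 = 0 from c.2, mul_zero, zero_mul, add_zero]
  have key : M.map δ = M * U - N * M := by
    ext1 i j
    rw [Matrix.sub_apply, Matrix.mul_apply, Matrix.mul_apply]
    simp only [Matrix.map_apply, hM, hN, hU, Matrix.of_apply]
    have e1 : ∑ k : Fin n, dx^[(i : ℕ)] (f k) * (c j k).1 =
        dx^[(i : ℕ)] (δ (f j) + t * f j) := by
      rw [hc j, Fin.sum_univ_eq_sum_range (fun k => dx^[(i : ℕ)] (f k) * (c j k).1) n,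
        dx_iterate_eq, map_sum, ← dx_iterate_eq]
      simp only [hiter]
      rw [← Finset.sum_subset (Finset.range_subset_range.mpr j.2.le)]
      · exact Finset.sum_congr rfl fun k _ => mul_comm _ _
      · intro k _ hk
        rw [hc0 j k (by simpa using hk)]
        exact mul_zero _
    have e2 : ∑ k : Fin n, ((if (k : ℕ) = i then t else 0) +
        if (k : ℕ) + 1 = i then (i : ℕ) * dx t else 0) * dx^[(k : ℕ)] (f j) =
        dx^[(i : ℕ)] (t * f j) := by
      rw [dx_iterate_mul_of_dx_const ht, Fin.sum_univ_eq_sum_range (fun k =>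
        ((if k = i then t else 0) + if k + 1 = (i : ℕ) then (i : ℕ) * dx t else 0) *
          dx^[k] (f j)) n]
      simp only [add_mul, ite_mul, zero_mul, Finset.sum_add_distrib]
      rw [Finset.sum_ite_eq', if_pos (Finset.mem_range.mpr i.2)]
      congr 1
      have hi := i.2
      generalize (i : ℕ) = i at hi
      rcases i with _ | i
      · simp
      · simp only [Nat.add_right_cancel_iff, Nat.add_sub_cancel]
        rw [Finset.sum_ite_eq', if_pos (Finset.mem_range.mpr (by omega))]
    rw [e1, e2, dx_iterate_add, add_sub_cancel_right, deriv_dx_iterate hδ]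
  have hNtr : N.trace = n * t := by
    simp [Matrix.trace, hN]
  have hUtr : U.trace = 0 := by
    rw [Matrix.trace]
    refine Finset.sum_eq_zero fun i _ => ?_
    rw [Matrix.diag_apply, hU, Matrix.of_apply, hc0 i i le_rfl]
    rfl
  change δ M.det + n * t * M.det = 0
  have h1 : (M.adjugate * (M * U)).trace = 0 := by
    rw [← mul_assoc, Matrix.adjugate_mul, Matrix.smul_mul, one_mul, Matrix.trace_smul, hUtr,
      smul_zero]
  have h2 : (M.adjugate * (N * M)).trace = M.det * (n * t) := by
    rw [Matrix.trace_mul_comm, mul_assoc, Matrix.mul_adjugate, Matrix.mul_smul, mul_one,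
      Matrix.trace_smul, hNtr, smul_eq_mul]
  rw [derivation_det, key, mul_sub, Matrix.trace_sub, h1, h2]
  ring

theorem dx_dx_time {K : Type*} [Field K] (t0 : ℕ+ →₀ K) (r : ℕ+) :
    dx (dx (time t0 r)) = 0 := by
  rw [dx_time]
  split_ifs
  · exact dx_one
  · exact dx_zero

end CKP

end

theorem proposition4p3 {K : Type*} [Field K] [CharZero K] (t0 : ℕ+ →₀ K) (r : ℕ+)
    (m : ℕ) [NeZero m] (W Winv : CKP.PsiDO K) (Φ Ψ : Fin m → CKP.Fn K)
    (hckp : CKP.IsCKP r W Winv Φ Ψ)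
    (hL : CKP.flowL t0 r W Winv = 0)
    (hΦ : ∀ i, CKP.flowPhi t0 r W Winv (Φ i) = 0)
    (χ : ℕ → Fin m → CKP.Fn K)
    (hχ0 : χ 0 = Φ)
    (hχ : ∀ s i, CKP.LaxActs (CKP.laxPow W Winv r) Φ Ψ (χ s i) (χ (s + 1) i))
    (n : ℕ) :
    CKP.stringOp t0 r n (CKP.wronskian n fun k => χ (k / m) (CKP.gen m k)) = 0 ∧
    ∀ (Lseq : ℕ → CKP.PsiDO K) (Φseq Ψseq : ℕ → Fin m → CKP.Fn K) (τ : ℕ → CKP.Fn K),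
      Lseq 0 = CKP.laxPow W Winv r → Φseq 0 = Φ → Ψseq 0 = Ψ → CKP.IsTau W Winv (τ 0) →
      CKP.IsDBOrbit n Lseq Φseq Ψseq τ →
      τ n * (τ 0)⁻¹ = CKP.wronskian n (fun k => χ (k / m) (CKP.gen m k)) ∧
      CKP.stringOp t0 r n (τ n * (τ 0)⁻¹) = 0 := by
  have hd := hckp.dressing
  have hstring : CKP.stringOp t0 r n (CKP.wronskian n fun k => χ (k / m) (CKP.gen m k)) = 0 := by
    rw [CKP.stringOp_eq]
    refine CKP.string_wronskian (CKP.euler_dx t0 r) (CKP.dx_dx_time t0 r) ?_ n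
    refine CKP.string_mem_lowerSpan (CKP.euler_dx t0 r) (hd.string_lax hL) hckp.lax_neg
      (fun i => ?_) (fun k hk => ?_) fun k => ?_
    · rw [← hd.flowPhi_eq fun l => hckp.eigen l i, hΦ]
    · rw [Nat.div_eq_of_lt hk, hχ0]
    · rw [Nat.add_div_right k (NeZero.pos m), CKP.gen_add_self]
      exact hχ _ _
  refine ⟨hstring, fun Lseq Φseq Ψseq τ hL0 hΦ0 hΨ0 hτ horb => ?_⟩
  have hW : τ n * (τ 0)⁻¹ = CKP.wronskian n fun k => χ (k / m) (CKP.gen m k) := by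
    have hchain : CKP.IsChain 0 (Lseq 0) (Φseq 0) (Ψseq 0)
        fun k => χ (k / m) (CKP.gen m k) := by
      rw [hL0, hΦ0, hΨ0]
      exact CKP.isChain_iterates hχ0 hχ
    rw [CKP.wronskian_eq_prod_of_orbit n 0 (by rw [hL0, hΦ0, hΨ0]; exact hckp.lax_neg)
      (by simpa only [zero_add] using horb.step) hchain, horb.tau_eq le_rfl, mul_assoc,
      CKP.mul_inv_of_isUnit hτ.1, mul_one]
    simp only [zero_add]
  exact ⟨hW, hW ▸ hstring⟩
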